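/- Conventions. Permutations are multiplied as maps, $(wv)(i)=w(v(i))$; $\ell(w)$ is the least number of adjacent transpositions whose product is $w$. For $p\in\mathfrak S_k$ and $w\in\mathfrak S_n$, the entries $w(i_1),\dots,w(i_k)$ with $i_1<\dots<i_k$ form a $p$-pattern in $w$ if they are in the same relative order as $p(1),\dots,p(k)$. The pair $(p,w)$ is *value-stable* if $w=w'v$ for some $w',v\in\mathfrak S_n$ with $\ell(w)=\ell(w')+\ell(v)$ such that $w'$ has a $p$-pattern in consecutive positions whose values also form a $p$-pattern in $w$. Fix $n$ unit vectors $d_1,\dots,d_n$ in the plane that point strictly downwards and whose directions turn counterclockwise as the index increases. For labels $i_1<\dots<i_k$ and $p\in\mathfrak S_k$, an *$X(p)$ with edges $i_1,\dots,i_k$* is the (possibly degenerate) polygon bounded by two paths that descend from a common top vertex: the left-hand one (which is convex) with successive edges $d_{i_1},\dots,d_{i_k}$, and the right-hand one with successive edges $d_{i_{p(1)}},\dots,d_{i_{p(k)}}$. *Elnitsky's polygon* $X(w)$ is the one with $k=n$ and $p=w\in\mathfrak S_n$; a *rhombus* is an $X(21)$. A *paw tiling* of $X(w)$ is an edge-to-edge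 tiling of $X(w)$ by finitely many such polygons $X(q)$ ($q$ any permutation), called *paws*; degenerate paws are permitted, provided their edges lie along edges of the tiling, and the parts of $X(w)$ where its two sides coincide need not be covered. An $X(p)$-paw in a paw tiling of $X(w)$ is *isolated* if in no paw tiling of $X(w)$ that contains this paw in this position, and whose other tiles are all rhombi, does one of these other rhombi share two edges with the right-hand side of the paw. **Theorem.** For all permutations $p\in\mathfrak S_k$ and $w\in\mathfrak S_n$, there is a paw tiling of $X(w)$ containing an isolated $X(p)$-paw if and only if the pair $(p,w)$ is value-stable. -/

import Mathlib

/-! ### Permutations: length, patterns, value-stable pairs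

Permutations of `{1, …, n}` are elements of `Equiv.Perm (Fin n)` (labels `0, …, n - 1`), multiplied as
maps: `(w * v) i = w (v i)`. -/

/-- `s` is an adjacent transposition. -/
def IsAdjTransposition {n : ℕ} (s : Equiv.Perm (Fin n)) : Prop :=
  ∃ i j : Fin n, (j : ℕ) = (i : ℕ) + 1 ∧ s = Equiv.swap i j

/-- The length of a permutation: the least number of factors in an expression of it as a product of
adjacent transpositions. -/
noncomputable def permLength {n : ℕ} (w : Equiv.Perm (Fin n)) : ℕ :=
  sInf {m | ∃ L : List (Equiv.Perm (Fin n)),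
    L.length = m ∧ (∀ s ∈ L, IsAdjTransposition s) ∧ L.prod = w}

/-- The entries of `w` in the positions `f 0 < f 1 < ⋯ < f (k - 1)` form a `p`-pattern. -/
def IsPatternAt {k n : ℕ} (p : Equiv.Perm (Fin k)) (w : Equiv.Perm (Fin n))
    (f : Fin k ↪o Fin n) : Prop :=
  ∀ i j : Fin k, p i < p j ↔ w (f i) < w (f j)

/-- The positions `f 0 < f 1 < ⋯` are consecutive. -/
def IsConsecutive {k n : ℕ} (f : Fin k ↪o Fin n) : Prop :=
  ∃ x : ℕ, ∀ i : Fin k, (f i : ℕ) = x + (i : ℕ)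

/-- `(p, w)` is value-stable: `w = w' v` with lengths adding, `w'` has a `p`-pattern in consecutive
positions, and the values of this occurrence also form a `p`-pattern in `w`. -/
def ValueStable {k n : ℕ} (p : Equiv.Perm (Fin k)) (w : Equiv.Perm (Fin n)) : Prop :=
  ∃ w' v : Equiv.Perm (Fin n),
    w = w' * v ∧ permLength w = permLength w' + permLength v ∧
    ∃ f' : Fin k ↪o Fin n, IsPatternAt p w' f' ∧ IsConsecutive f' ∧
      ∃ f : Fin k ↪o Fin n, IsPatternAt p w f ∧
        Set.range (fun i => w (f i)) = Set.range (fun i => w' (f' i))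

/-! ### Elnitsky polygons in the plane -/

/-- Admissible edge vectors: `d i` is the vector of a side labelled `i`, traversed downwards. They are
unit vectors pointing strictly downwards, and turn counterclockwise as the label increases, so that the
path with labels in increasing order, read from the top, is the convex left half of a polygon. -/
structure IsEdgeSystem {n : ℕ} (d : Fin n → ℝ × ℝ) : Prop where
  unit : ∀ i, (d i).1 ^ 2 + (d i).2 ^ 2 = 1
  down : ∀ i, (d i).2 < 0
  ccw : ∀ i j, i < j → 0 < (d i).1 * (d j).2 - (d i).2 * (d j).1

/-- The vertex reached from `t` after the first `j` steps of the path with labels `s 0, s 1, …`. -/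
noncomputable def pathVertex {n k : ℕ} (d : Fin n → ℝ × ℝ) (t : ℝ × ℝ) (s : Fin k → Fin n)
    (j : ℕ) : ℝ × ℝ :=
  t + ∑ m ∈ Finset.univ.filter (fun m : Fin k => (m : ℕ) < j), d (s m)

/-- The edges of the path from `t` with labels `s 0, s 1, …`. An edge is recorded by its upper endpoint
and its label. -/
def pathEdges {n k : ℕ} (d : Fin n → ℝ × ℝ) (t : ℝ × ℝ) (s : Fin k → Fin n) :
    Set ((ℝ × ℝ) × Fin n) :=
  Set.range fun m : Fin k => (pathVertex d t s m, s m)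

/-- The points of the path from `t` with labels `s 0, s 1, …`. -/
def pathTrace {n k : ℕ} (d : Fin n → ℝ × ℝ) (t : ℝ × ℝ) (s : Fin k → Fin n) : Set (ℝ × ℝ) :=
  {t} ∪ ⋃ e ∈ pathEdges d t s, segment ℝ e.1 (e.1 + d e.2)

/-- An Elnitsky polygon with edges among the labels `0, …, n - 1`: its top vertex, its labels
`label 0 < ⋯ < label (size - 1)`, and the permutation giving the order of the labels on its
right-hand side. -/
structure ElnitskyPolygon (n : ℕ) where
  size : ℕ
  top : ℝ × ℝ
  label : Fin size ↪o Fin n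
  perm : Equiv.Perm (Fin size)

namespace ElnitskyPolygon

/-- The polygon `X(w)`, with its top vertex at the origin: from the top, its left half has the labels
`0, …, n - 1` and its right half the labels `w 0, …, w (n - 1)`. -/
def X {n : ℕ} (w : Equiv.Perm (Fin n)) : ElnitskyPolygon n :=
  ⟨n, 0, RelEmbedding.refl _, w⟩

variable {n : ℕ} (d : Fin n → ℝ × ℝ) (P : ElnitskyPolygon n)

/-- Edges of the left half: the labels increase from top to bottom. -/
def leftEdges : Set ((ℝ × ℝ) × Fin n) :=
  pathEdges d P.top P.label

/-- Edges of the right half. -/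
def rightEdges : Set ((ℝ × ℝ) × Fin n) :=
  pathEdges d P.top (fun i => P.label (P.perm i))

/-- The closed region enclosed by the left and right halves (both of which descend strictly): the union
of the horizontal segments that join them. -/
def region : Set (ℝ × ℝ) :=
  {z | ∃ l ∈ pathTrace d P.top P.label, ∃ r ∈ pathTrace d P.top (fun i => P.label (P.perm i)),
    l.2 = z.2 ∧ r.2 = z.2 ∧ l.1 ≤ z.1 ∧ z.1 ≤ r.1}

/-- `P` is (a translate, with edges parallel to those with the labels of `P`, of) an `X(p)`. -/
def IsPaw {k : ℕ} (p : Equiv.Perm (Fin k)) : Prop :=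
  ∃ (t : ℝ × ℝ) (l : Fin k ↪o Fin n), P = ⟨k, t, l, p⟩

/-- A rhombus is an `X(21)`. -/
def IsRhombus : Prop :=
  P.IsPaw (Equiv.swap (0 : Fin 2) 1)

end ElnitskyPolygon

open ElnitskyPolygon in
/-- `T` is a paw tiling of `X(w)`: finitely many Elnitsky polygons inside `X(w)`, which cover its
interior, do not overlap, and meet edge to edge. Polygons may be degenerate (the two halves may share
edges or vertices), so degenerate parts of `X(w)` need not be covered, and non-overlapping means that no
tile meets the interior of another one. Edge to edge means that every edge on the right-hand side of a
tile is on the right border of `X(w)` or has another tile on its other side, with that edge on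
its left-hand side only, and symmetrically. -/
structure IsPawTiling {n : ℕ} (d : Fin n → ℝ × ℝ) (w : Equiv.Perm (Fin n))
    (T : Set (ElnitskyPolygon n)) : Prop where
  finite : T.Finite
  inside : ∀ P ∈ T, P.region d ⊆ (X w).region d
  cover : interior ((X w).region d) ⊆ ⋃ P ∈ T, P.region d
  no_overlap : ∀ P ∈ T, ∀ Q ∈ T, P ≠ Q → Disjoint (interior (P.region d)) (Q.region d)
  right_edge : ∀ P ∈ T, ∀ e ∈ P.rightEdges d,
    e ∈ (X w).rightEdges d ∨ ∃ Q ∈ T, e ∈ Q.leftEdges d ∧ e ∉ Q.rightEdges d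
  left_edge : ∀ P ∈ T, ∀ e ∈ P.leftEdges d,
    e ∈ (X w).leftEdges d ∨ ∃ Q ∈ T, e ∈ Q.rightEdges d ∧ e ∉ Q.leftEdges d

/-- `Q` shares two edges with the right-hand side of `P`. -/
def SharesTwoRightEdges {n : ℕ} (d : Fin n → ℝ × ℝ) (Q P : ElnitskyPolygon n) : Prop :=
  ∃ e₁ e₂, e₁ ≠ e₂ ∧ e₁ ∈ Q.leftEdges d ∪ Q.rightEdges d ∧ e₂ ∈ Q.leftEdges d ∪ Q.rightEdges d ∧
    e₁ ∈ P.rightEdges d ∧ e₂ ∈ P.rightEdges d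

/-- The paw `P` of `X(w)` is isolated: in no paw tiling of `X(w)` that contains `P`, all of whose other
tiles are rhombi, does one of these rhombi share two edges with the right-hand side of `P`. -/
def IsIsolatedPaw {n : ℕ} (d : Fin n → ℝ × ℝ) (w : Equiv.Perm (Fin n))
    (P : ElnitskyPolygon n) : Prop :=
  ∀ T : Set (ElnitskyPolygon n), IsPawTiling d w T → P ∈ T →
    (∀ Q ∈ T, Q ≠ P → Q.IsRhombus) →
    ∀ Q ∈ T, Q ≠ P → ¬ SharesTwoRightEdges d Q P

/-! ### Lists under ascending adjacent swaps -/

section SwapSteps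

variable {α : Type*}

/-! A descending edge path from the top of `X(w)` is recorded by its word of labels; the left border
is then the identity word and the right border is `w`. Exchanging two adjacent ascending labels
moves the path to the right across one rhombus, so a chain in the weak order is a rhombus tiling of
the part between its ends (`WeakLE.exists_rhombus_tiling`). Lengths add in `w = u v` exactly when `u
≤ w` in this order, and comparability is inclusion of inversion sets (`weakLE_of_inversions`).

The main point is `IsPawTiling.exists_weakLE`: in every paw tiling the right half `R` of a tile
extends to a path `A R B` below `w`. Any path of edges lying on the right border or on left halves
of tiles can be pushed to the right across whole tiles until it becomes the border. Degenerate paws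
are first cut at the vertices common to their two halves. A convexity estimate shows that away from
these cuts a paw really has interior just to the right of its left vertices; with non-overlap and
containment in `X(w)` this makes the pushing possible.

If `P` is isolated, take `A R B ≤ w`. A descent of `R` is an inversion and persists in `w`. An
ascent of `R` inverted in `w` could be exchanged at once without leaving the interval below `w`, and
the corresponding rhombus would share two edges with `P` (`IsIsolatedPaw.not_inversion`). Hence `R`
occurs in `w` in the same order, which is value-stability with `w' = A R B`.

Conversely, if `w' = A R B ≤ w` and `R` is a subword of `w`, a paw with right half `R` fits into a
tiling with rhombi elsewhere. A rhombus sharing two edges with its right half does so along an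
ascent `a b` of `R` (`SharesTwoRightEdges.exists_ascent`); its own right half `b a` lies on a path
below `w`, so `w` inverts a pair that `R` keeps in order, which is impossible. -/

theorem pair_sublist_cons {x y a : α} {L : List α} :
    [x, y].Sublist (a :: L) ↔ (x = a ∧ y ∈ L) ∨ [x, y].Sublist L := by
  rw [List.sublist_cons_iff]
  constructor
  · rintro (h | ⟨r, h, h'⟩)
    · exact Or.inr h
    · simp only [List.cons.injEq] at h
      obtain ⟨rfl, rfl⟩ := h
      exact Or.inl ⟨rfl, List.singleton_sublist.1 h'⟩
  · rintro (⟨rfl, h⟩ | h)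
    · exact Or.inr ⟨[y], rfl, List.singleton_sublist.2 h⟩
    · exact Or.inl h

theorem pair_sublist_append {x y : α} {A B : List α} :
    [x, y].Sublist (A ++ B) ↔ [x, y].Sublist A ∨ (x ∈ A ∧ y ∈ B) ∨ [x, y].Sublist B := by
  induction A with
  | nil => simp
  | cons a A ih =>
    rw [List.cons_append, pair_sublist_cons, pair_sublist_cons, ih]
    simp only [List.mem_append, List.mem_cons]
    tauto

theorem pair_sublist_total {x y : α} {W : List α} (h : x ≠ y) (hx : x ∈ W) (hy : y ∈ W) :
    [x, y].Sublist W ∨ [y, x].Sublist W := by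
  induction W with
  | nil => simp at hx
  | cons z W ih =>
    simp only [pair_sublist_cons]
    simp only [List.mem_cons] at hx hy
    grind

variable [LinearOrder α]

/-- `V` arises from `U` by exchanging two adjacent entries that are in increasing order. -/
def SwapStep (U V : List α) : Prop :=
  ∃ (A B : List α) (a b : α), a < b ∧ U = A ++ a :: b :: B ∧ V = A ++ b :: a :: B

/-- `V` arises from `U` by finitely many ascending adjacent swaps: the weak order. -/
abbrev WeakLE : List α → List α → Prop :=
  Relation.ReflTransGen SwapStep

/-- The number of inversions of a list. -/
def invCount : List α → ℕ
  | [] => 0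
  | a :: L => L.countP (· < a) + invCount L

theorem idxOf_lt_of_pair_sublist {x y : α} {W : List α} (hW : W.Nodup) (h : [x, y].Sublist W) :
    W.idxOf x < W.idxOf y := by
  induction W with
  | nil => simp at h
  | cons z W ih =>
    rw [List.nodup_cons] at hW
    rw [pair_sublist_cons] at h
    rcases h with ⟨rfl, hy⟩ | h
    · have : x ≠ y := fun e => hW.1 (e ▸ hy)
      rw [List.idxOf_cons_self, List.idxOf_cons_ne _ this]
      omega
    · have hx : x ∈ W := h.subset (by simp)
      have hy : y ∈ W := h.subset (by simp)
      rw [List.idxOf_cons_ne _ (fun e : z = x => hW.1 (e ▸ hx)),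
        List.idxOf_cons_ne _ (fun e : z = y => hW.1 (e ▸ hy))]
      have := ih hW.2 h
      omega

theorem not_pair_sublist_swap {x y : α} {W : List α} (hW : W.Nodup) (h : [x, y].Sublist W) :
    ¬ [y, x].Sublist W := fun h' =>
  lt_asymm (idxOf_lt_of_pair_sublist hW h) (idxOf_lt_of_pair_sublist hW h')

theorem SwapStep.perm {U V : List α} (h : SwapStep U V) : U.Perm V := by
  obtain ⟨A, B, a, b, -, rfl, rfl⟩ := h
  exact (List.Perm.swap b a B).append_left A

theorem SwapStep.context {U V : List α} (h : SwapStep U V) (A B : List α) :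
    SwapStep (A ++ U ++ B) (A ++ V ++ B) := by
  obtain ⟨A', B', a, b, hab, rfl, rfl⟩ := h
  exact ⟨A ++ A', B' ++ B, a, b, hab, by simp, by simp⟩

theorem WeakLE.perm {U V : List α} (h : WeakLE U V) : U.Perm V := by
  induction h with
  | refl => exact List.Perm.refl _
  | tail _ h ih => exact ih.trans h.perm

theorem WeakLE.context {U V : List α} (h : WeakLE U V) (A B : List α) :
    WeakLE (A ++ U ++ B) (A ++ V ++ B) :=
  Relation.ReflTransGen.lift (fun X => A ++ X ++ B) (fun _ _ h => SwapStep.context h A B) _ _ h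

/-- The only pair whose order changes was increasing before, so no inversion is lost. -/
theorem SwapStep.inversion {U V : List α} (h : SwapStep U V) {x y : α} (hxy : x < y)
    (hU : [y, x].Sublist U) : [y, x].Sublist V := by
  obtain ⟨A, B, a, b, hab, rfl, rfl⟩ := h
  simp only [pair_sublist_append, pair_sublist_cons, List.mem_cons] at hU ⊢
  grind

theorem WeakLE.inversion {U V : List α} (h : WeakLE U V) {x y : α} (hxy : x < y)
    (hU : [y, x].Sublist U) : [y, x].Sublist V := by
  induction h with
  | refl => exact hU
  | tail _ h ih => exact h.inversion hxy ih

/-- Entries in front keep the same multiset of later entries; of the exchanged two, `b` gains the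
smaller `a` behind it and `a` loses only the larger `b`. -/
theorem SwapStep.invCount_eq {U V : List α} (h : SwapStep U V) : invCount V = invCount U + 1 := by
  obtain ⟨A, B, a, b, hab, rfl, rfl⟩ := h
  induction A with
  | nil => simp [invCount, hab, hab.le]; omega
  | cons z A ih =>
    simp only [List.cons_append, invCount, ih]
    have := ((List.Perm.swap b a B).append_left A).countP_eq (· < z)
    rw [this]
    omega

theorem WeakLE.invCount_le {U V : List α} (h : WeakLE U V) : invCount U ≤ invCount V := by
  induction h with
  | refl => exact le_rfl
  | tail _ h ih => rw [h.invCount_eq]; omega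

theorem WeakLE.invCount_lt {U V : List α} (h : WeakLE U V) (hne : U ≠ V) :
    invCount U < invCount V := by
  rcases Relation.ReflTransGen.cases_head h with rfl | ⟨U', h', h''⟩
  · exact absurd rfl hne
  · have := WeakLE.invCount_le h''
    rw [h'.invCount_eq] at this
    omega

theorem invCount_le_sq (U : List α) : invCount U ≤ U.length ^ 2 := by
  induction U with
  | nil => simp [invCount]
  | cons a U ih =>
    have := List.countP_le_length (p := (· < a)) (l := U)
    simp only [invCount, List.length_cons]
    nlinarith

/-- Inclusion of inversion sets implies comparability in the weak order. -/
theorem weakLE_of_inversions {U W : List α} (hW : W.Nodup) (hp : U.Perm W)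
    (h : ∀ x y, x < y → [y, x].Sublist U → [y, x].Sublist W) : WeakLE U W := by
  -- Every swap raises `invCount`, which is bounded by the squared length, so the difference is a
  -- termination measure.
  induction hm : W.length ^ 2 - invCount U using Nat.strong_induction_on generalizing U with
  | _ m ih =>
    by_cases hex : ∃ (A B : List α) (a b : α), U = A ++ a :: b :: B ∧ a < b ∧ [b, a].Sublist W
    · obtain ⟨A, B, a, b, rfl, hab, hba⟩ := hex
      have hs : SwapStep (A ++ a :: b :: B) (A ++ b :: a :: B) := ⟨A, B, a, b, hab, rfl, rfl⟩
      have h1 := hs.invCount_eq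
      have h2 := invCount_le_sq (A ++ b :: a :: B)
      have h3 : (A ++ b :: a :: B).length = W.length := (hs.perm.symm.trans hp).length_eq
      rw [h3] at h2
      refine Relation.ReflTransGen.head hs
        (ih (W.length ^ 2 - invCount (A ++ b :: a :: B)) (by omega) (hs.perm.symm.trans hp) ?_ rfl)
      -- The swap creates only the inversion of `a` and `b`, which `W` has as well.
      intro x y hxy hs'
      have h0 := h x y hxy
      simp only [pair_sublist_append, pair_sublist_cons, List.mem_cons] at hs' h0
      by_cases e : x = a ∧ y = b
      · obtain ⟨rfl, rfl⟩ := e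
        exact hba
      · exact h0 (by grind)
    -- With no such ascent left, any two neighbours of `U` stand in the order they have in `W`, so
    -- both lists are sorted by the same relation.
    · have hU : U.Nodup := hp.nodup_iff.2 hW
      let r : α → α → Prop := fun x y => W.idxOf x < W.idxOf y
      have : Trans r r r := ⟨fun h1 h2 => lt_trans h1 h2⟩
      have hc : U.IsChain r := by
        rw [List.isChain_iff_forall_rel_of_append_cons_cons]
        rintro a b A B rfl
        have hs : [a, b].Sublist (A ++ a :: b :: B) := by
          simp
        have hne : a ≠ b := by
          rintro rfl
          exact not_pair_sublist_swap hU hs hs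
        refine idxOf_lt_of_pair_sublist hW ?_
        rcases lt_or_gt_of_ne hne with hab | hab
        · rcases pair_sublist_total hne (hp.subset (hs.subset (by simp)))
            (hp.subset (hs.subset (by simp))) with h' | h'
          · exact h'
          · exact absurd ⟨A, B, a, b, rfl, hab, h'⟩ hex
        · exact h b a hab hs
      have hWr : W.Pairwise r :=
        List.pairwise_iff_forall_sublist.2 fun h => idxOf_lt_of_pair_sublist hW h
      have : U = W := hp.eq_of_pairwise (fun a b _ _ h1 h2 => absurd h1 (lt_asymm h2))
        (List.isChain_iff_pairwise.1 hc) hWr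
      rw [this]

theorem weakLE_of_pairwise_lt {L R : List α} (hL : L.Pairwise (· < ·)) (hp : L.Perm R) :
    WeakLE L R :=
  weakLE_of_inversions (hp.nodup_iff.1 (hL.imp ne_of_lt)) hp fun _ _ hxy h =>
    absurd (List.pairwise_iff_forall_sublist.1 hL h) (lt_asymm hxy)

theorem invCount_eq_zero_of_pairwise_lt {L : List α} (hL : L.Pairwise (· < ·)) :
    invCount L = 0 := by
  induction L with
  | nil => rfl
  | cons a L ih =>
    rw [List.pairwise_cons] at hL
    simp only [invCount, ih hL.2, add_zero, List.countP_eq_zero, decide_eq_true_eq, not_lt]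
    exact fun b hb => (hL.1 b hb).le

end SwapSteps

/-! ### Length and the weak order -/

section PermLength

variable {n : ℕ}

theorem exists_perm_ofFn_eq {u : Equiv.Perm (Fin n)} {V : List (Fin n)}
    (h : (List.ofFn u).Perm V) : ∃ v : Equiv.Perm (Fin n), List.ofFn v = V := by
  have hl : V.length = n := by rw [← h.length_eq, List.length_ofFn]
  have hn : V.Nodup := h.nodup_iff.1 (List.nodup_ofFn.2 u.injective)
  have hg : Function.Injective (fun i : Fin n => V.get (i.cast hl.symm)) :=
    (List.nodup_iff_injective_get.1 hn).comp (Fin.cast_injective _)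
  refine ⟨Equiv.ofBijective _ (Finite.injective_iff_bijective.1 hg), ?_⟩
  apply List.ext_getElem <;> simp [hl]

theorem ofFn_eq_take_append_cons_cons_drop {α : Type*} (g : Fin n → α) {i j : Fin n}
    (hij : (j : ℕ) = i + 1) :
    List.ofFn g = (List.ofFn g).take i ++ g i :: g j :: (List.ofFn g).drop (i + 2) := by
  have hi : (i : ℕ) < (List.ofFn g).length := by simp
  have hj : (i : ℕ) + 1 < (List.ofFn g).length := by simp [← hij]
  conv_lhs => rw [← List.take_append_drop i (List.ofFn g), List.drop_eq_getElem_cons hi,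
    List.drop_eq_getElem_cons hj]
  simp only [List.getElem_ofFn, Fin.eta, ← hij]
  rw [show (j : ℕ) + 1 = i + 2 by omega]

/-- Right multiplication acts on positions, so an adjacent transposition exchanges two neighbours of
the one-line word. This ties `permLength` to `SwapStep`. -/
theorem ofFn_mul_swap_eq (u : Equiv.Perm (Fin n)) {i j : Fin n} (hij : (j : ℕ) = i + 1) :
    ∃ A B : List (Fin n), A.length = i ∧ List.ofFn u = A ++ u i :: u j :: B ∧
      List.ofFn (u * Equiv.swap i j) = A ++ u j :: u i :: B := by
  refine ⟨(List.ofFn u).take i, (List.ofFn u).drop (i + 2), by simp,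
    ofFn_eq_take_append_cons_cons_drop u hij, ?_⟩
  rw [ofFn_eq_take_append_cons_cons_drop (u * Equiv.swap i j) hij]
  congr 1
  · apply List.ext_getElem
    · simp
    · intro m h1 h2
      simp only [List.length_take, List.length_ofFn, lt_inf_iff] at h1
      simp only [List.getElem_take, List.getElem_ofFn, Equiv.Perm.coe_mul, Function.comp_apply]
      rw [Equiv.swap_apply_of_ne_of_ne] <;> rw [Ne, Fin.ext_iff] <;> simp only <;> omega
  · congr 1
    · simp
    · congr 1
      · simp
      · apply List.ext_getElem
        · simp
        · intro m h1 h2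
          simp only [List.length_drop, List.length_ofFn] at h1
          simp only [List.getElem_drop, List.getElem_ofFn, Equiv.Perm.coe_mul, Function.comp_apply]
          rw [Equiv.swap_apply_of_ne_of_ne] <;> rw [Ne, Fin.ext_iff] <;> simp only <;> omega

theorem swapStep_mul_adjTransposition (u : Equiv.Perm (Fin n)) {s : Equiv.Perm (Fin n)}
    (hs : IsAdjTransposition s) :
    SwapStep (List.ofFn u) (List.ofFn (u * s)) ∨ SwapStep (List.ofFn (u * s)) (List.ofFn u) := by
  obtain ⟨i, j, hij, rfl⟩ := hs
  obtain ⟨A, B, -, e1, e2⟩ := ofFn_mul_swap_eq u hij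
  have hne : u i ≠ u j := by
    intro h
    have := u.injective h
    rw [← this] at hij
    omega
  rcases lt_or_gt_of_ne hne with h | h
  · exact Or.inl ⟨A, B, _, _, h, e1, e2⟩
  · exact Or.inr ⟨A, B, _, _, h, e2, e1⟩

theorem invCount_mul_prod_le (u : Equiv.Perm (Fin n)) (M : List (Equiv.Perm (Fin n)))
    (hM : ∀ s ∈ M, IsAdjTransposition s) :
    invCount (List.ofFn (u * M.prod)) ≤ invCount (List.ofFn u) + M.length := by
  induction M generalizing u with
  | nil => simp
  | cons s M ih =>
    have h1 := ih (u * s) (fun t ht => hM t (List.mem_cons_of_mem _ ht))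
    rw [List.prod_cons, ← mul_assoc, List.length_cons]
    rcases swapStep_mul_adjTransposition u (hM s List.mem_cons_self) with h | h <;>
      have := h.invCount_eq <;> omega

/-- Each factor changes the inversion number by exactly one, so a gain of `M.length` forces every
factor to be an ascending swap. -/
theorem weakLE_mul_prod (u : Equiv.Perm (Fin n)) (M : List (Equiv.Perm (Fin n)))
    (hM : ∀ s ∈ M, IsAdjTransposition s)
    (h : invCount (List.ofFn u) + M.length ≤ invCount (List.ofFn (u * M.prod))) :
    WeakLE (List.ofFn u) (List.ofFn (u * M.prod)) := by
  induction M generalizing u with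
  | nil => simp only [List.prod_nil, mul_one]; exact Relation.ReflTransGen.refl
  | cons s M ih =>
    have hM' : ∀ t ∈ M, IsAdjTransposition t := fun t ht => hM t (List.mem_cons_of_mem _ ht)
    have h1 := invCount_mul_prod_le (u * s) M hM'
    rw [List.prod_cons, ← mul_assoc] at h ⊢
    rw [List.length_cons] at h
    rcases swapStep_mul_adjTransposition u (hM s List.mem_cons_self) with h2 | h2 <;>
      have h3 := h2.invCount_eq
    · exact Relation.ReflTransGen.head h2 (ih (u * s) hM' (by omega))
    · omega

theorem exists_adjTransposition_of_swapStep {u v : Equiv.Perm (Fin n)}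
    (h : SwapStep (List.ofFn u) (List.ofFn v)) :
    ∃ s, IsAdjTransposition s ∧ v = u * s := by
  obtain ⟨A, B, a, b, hab, e1, e2⟩ := h
  have hl := congrArg List.length e1
  simp only [List.length_ofFn, List.length_append, List.length_cons] at hl
  let i : Fin n := ⟨A.length, by omega⟩
  let j : Fin n := ⟨A.length + 1, by omega⟩
  refine ⟨Equiv.swap i j, ⟨i, j, rfl, rfl⟩, ?_⟩
  obtain ⟨A', B', hA', e3, e4⟩ := ofFn_mul_swap_eq u (i := i) (j := j) rfl
  obtain ⟨rfl, h2⟩ := List.append_inj (e1.symm.trans e3) hA'.symm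
  simp only [List.cons.injEq] at h2
  obtain ⟨ha, hb, hB⟩ := h2
  rw [ha, hb, hB] at e2
  exact DFunLike.coe_injective (List.ofFn_injective (e2.trans e4.symm))

theorem exists_word_of_weakLE {u w : Equiv.Perm (Fin n)}
    (h : WeakLE (List.ofFn u) (List.ofFn w)) :
    ∃ M : List (Equiv.Perm (Fin n)), (∀ s ∈ M, IsAdjTransposition s) ∧ w = u * M.prod ∧
      invCount (List.ofFn u) + M.length = invCount (List.ofFn w) := by
  generalize hV : List.ofFn w = V at h ⊢
  induction h generalizing w with
  | refl =>
    refine ⟨[], by simp, ?_, by simp⟩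
    rw [List.prod_nil, mul_one]
    exact DFunLike.coe_injective (List.ofFn_injective hV)
  | @tail V V' h1 h2 ih =>
    obtain ⟨v, rfl⟩ := exists_perm_ofFn_eq (WeakLE.perm h1)
    obtain ⟨M, hM, rfl, hlen⟩ := ih rfl
    subst hV
    obtain ⟨s, hs, rfl⟩ := exists_adjTransposition_of_swapStep h2
    refine ⟨M ++ [s], ?_, by simp [mul_assoc], ?_⟩
    · intro t ht
      rcases List.mem_append.1 ht with ht | ht
      · exact hM t ht
      · rw [List.mem_singleton.1 ht]
        exact hs
    · rw [h2.invCount_eq, ← hlen, List.length_append, List.length_singleton, add_assoc]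

theorem permLength_le_of_word {w : Equiv.Perm (Fin n)} {M : List (Equiv.Perm (Fin n))}
    (hM : ∀ s ∈ M, IsAdjTransposition s) (h : M.prod = w) : permLength w ≤ M.length :=
  Nat.sInf_le ⟨M, rfl, hM, h⟩

theorem pairwise_lt_ofFn_one : (List.ofFn (1 : Equiv.Perm (Fin n))).Pairwise (· < ·) := by
  rw [List.pairwise_ofFn]
  exact fun i j h => h

theorem weakLE_ofFn_one {V : List (Fin n)} (w : Equiv.Perm (Fin n)) (h : V.Perm (List.ofFn w)) :
    WeakLE (List.ofFn (1 : Equiv.Perm (Fin n))) V :=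
  weakLE_of_pairwise_lt pairwise_lt_ofFn_one
    ((Equiv.Perm.ofFn_comp_perm w (1 : Equiv.Perm (Fin n))).symm.trans h.symm)

theorem exists_reduced_word (w : Equiv.Perm (Fin n)) :
    ∃ M : List (Equiv.Perm (Fin n)), M.length = permLength w ∧
      (∀ s ∈ M, IsAdjTransposition s) ∧ M.prod = w := by
  obtain ⟨M, hM, h, -⟩ := exists_word_of_weakLE (weakLE_ofFn_one w (List.Perm.refl _))
  rw [one_mul] at h
  exact Nat.sInf_mem (s := {m | ∃ L : List (Equiv.Perm (Fin n)),
    L.length = m ∧ (∀ s ∈ L, IsAdjTransposition s) ∧ L.prod = w}) ⟨M.length, M, rfl, hM, h.symm⟩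

/-- A chain from the identity word yields a word with one letter per inversion; conversely a letter
adds at most one inversion. -/
theorem permLength_eq_invCount (w : Equiv.Perm (Fin n)) :
    permLength w = invCount (List.ofFn w) := by
  have h0 := invCount_eq_zero_of_pairwise_lt (pairwise_lt_ofFn_one (n := n))
  apply le_antisymm
  · obtain ⟨M, hM, h, hlen⟩ := exists_word_of_weakLE (weakLE_ofFn_one w (List.Perm.refl _))
    rw [one_mul] at h
    have := permLength_le_of_word hM h.symm
    omega
  · obtain ⟨M, hl, hM, h⟩ := exists_reduced_word w
    have := invCount_mul_prod_le 1 M hM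
    rw [one_mul, h] at this
    omega

theorem weakLE_of_permLength_add {u v : Equiv.Perm (Fin n)}
    (h : permLength (u * v) = permLength u + permLength v) :
    WeakLE (List.ofFn u) (List.ofFn (u * v)) := by
  obtain ⟨M, hl, hM, rfl⟩ := exists_reduced_word v
  rw [permLength_eq_invCount, permLength_eq_invCount u, ← hl] at h
  exact weakLE_mul_prod u M hM h.ge

/-- The chain spells `u⁻¹ * w` with as many letters as inversions are gained, and no shorter word
can produce that gain. -/
theorem permLength_add_of_weakLE {u w : Equiv.Perm (Fin n)}
    (h : WeakLE (List.ofFn u) (List.ofFn w)) :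
    permLength w = permLength u + permLength (u⁻¹ * w) := by
  obtain ⟨M, hM, hw, hlen⟩ := exists_word_of_weakLE h
  have h1 : permLength (u⁻¹ * w) ≤ M.length := permLength_le_of_word hM (by simp [hw])
  obtain ⟨N, hl, hN, hNw⟩ := exists_reduced_word (u⁻¹ * w)
  have h2 := invCount_mul_prod_le u N hN
  rw [hNw, mul_inv_cancel_left] at h2
  rw [permLength_eq_invCount w, permLength_eq_invCount u]
  omega

end PermLength

/-! ### Descending edge paths given by lists of labels -/

section LabelPaths

variable {n : ℕ} {d : Fin n → ℝ × ℝ}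

/-- The displacement along a path whose edges have the labels `L`. -/
def labelSum (d : Fin n → ℝ × ℝ) (L : List (Fin n)) : ℝ × ℝ :=
  (L.map d).sum

@[simp]
theorem labelSum_nil : labelSum d [] = 0 := rfl

@[simp]
theorem labelSum_cons (a : Fin n) (L : List (Fin n)) :
    labelSum d (a :: L) = d a + labelSum d L := by
  simp [labelSum]

@[simp]
theorem labelSum_append (A B : List (Fin n)) :
    labelSum d (A ++ B) = labelSum d A + labelSum d B := by
  simp [labelSum]

theorem labelSum_perm {L R : List (Fin n)} (h : L.Perm R) : labelSum d L = labelSum d R :=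
  (h.map d).sum_eq

theorem labelSum_snd_nonpos (hd : ∀ i, (d i).2 < 0) (L : List (Fin n)) :
    (labelSum d L).2 ≤ 0 := by
  induction L with
  | nil => simp
  | cons a L ih =>
    rw [labelSum_cons, Prod.snd_add]
    linarith [hd a]

theorem labelSum_snd_neg (hd : ∀ i, (d i).2 < 0) {L : List (Fin n)} (hL : L ≠ []) :
    (labelSum d L).2 < 0 := by
  cases L with
  | nil => exact absurd rfl hL
  | cons a L =>
    rw [labelSum_cons, Prod.snd_add]
    linarith [hd a, labelSum_snd_nonpos hd L]

theorem eq_nil_of_labelSum_eq_zero (hd : ∀ i, (d i).2 < 0) {L : List (Fin n)}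
    (h : labelSum d L = 0) : L = [] := by
  by_contra hL
  have := labelSum_snd_neg hd hL
  rw [h] at this
  simp at this

/-- A vertex of a path determines the part of the path above it. -/
theorem append_inj_of_labelSum_snd (hd : ∀ i, (d i).2 < 0) {A B A' B' : List (Fin n)}
    (h : A ++ B = A' ++ B') (hs : (labelSum d A).2 = (labelSum d A').2) : A = A' ∧ B = B' := by
  have key : ∀ C : List (Fin n), (labelSum d C).2 = 0 → C = [] := fun C hC => by
    by_contra hne
    exact (labelSum_snd_neg hd hne).ne hC
  rcases List.append_eq_append_iff.1 h with ⟨C, rfl, rfl⟩ | ⟨C, rfl, rfl⟩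
  · obtain rfl := key C (by simpa using hs)
    simp
  · obtain rfl := key C (by simpa using hs)
    simp

theorem append_inj_of_labelSum (hd : ∀ i, (d i).2 < 0) {A B A' B' : List (Fin n)}
    (h : A ++ B = A' ++ B') (hs : labelSum d A = labelSum d A') : A = A' ∧ B = B' :=
  append_inj_of_labelSum_snd hd h (by rw [hs])

/-- The edges of the path from `t` with the labels `L`. -/
def listEdges (d : Fin n → ℝ × ℝ) (t : ℝ × ℝ) (L : List (Fin n)) : Set ((ℝ × ℝ) × Fin n) :=
  {e | ∃ A B, L = A ++ e.2 :: B ∧ e.1 = t + labelSum d A}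

theorem listEdges_append (t : ℝ × ℝ) (A B : List (Fin n)) :
    listEdges d t (A ++ B) = listEdges d t A ∪ listEdges d (t + labelSum d A) B := by
  ext ⟨v, a⟩
  constructor
  · rintro ⟨C, D, h, hv⟩
    rcases List.append_eq_append_iff.1 h with ⟨E, rfl, rfl⟩ | ⟨E, rfl, h2⟩
    · exact Or.inr ⟨E, D, rfl, by simp only at hv; rw [hv, labelSum_append, add_assoc]⟩
    · rcases E with _ | ⟨x, E⟩
      · simp only [List.nil_append] at h2
        subst h2
        exact Or.inr ⟨[], D, rfl, by simpa using hv⟩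
      · simp only [List.cons_append, List.cons.injEq] at h2
        obtain ⟨rfl, rfl⟩ := h2
        exact Or.inl ⟨C, E, rfl, hv⟩
  · rintro (⟨C, D, rfl, hv⟩ | ⟨C, D, rfl, hv⟩)
    · exact ⟨C, D ++ B, by simp, hv⟩
    · exact ⟨A ++ C, D, by simp, by rw [hv, labelSum_append, add_assoc]⟩

theorem listEdges_cons (t : ℝ × ℝ) (a : Fin n) (L : List (Fin n)) :
    listEdges d t (a :: L) = {(t, a)} ∪ listEdges d (t + d a) L := by
  have := listEdges_append (d := d) t [a] L
  rw [List.singleton_append] at this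
  rw [this]
  congr 1
  · ext ⟨v, b⟩
    constructor
    · rintro ⟨C, D, h, hv⟩
      rcases C with _ | ⟨c, C⟩
      · simp_all
      · simp at h
    · rintro h
      rw [Set.mem_singleton_iff, Prod.mk.injEq] at h
      obtain ⟨rfl, rfl⟩ := h
      exact ⟨[], [], rfl, by simp⟩
  · simp

@[simp]
theorem listEdges_nil (t : ℝ × ℝ) : listEdges d t [] = ∅ := by
  ext e
  simp [listEdges]

theorem exists_maximal_common_start (U W : List (Fin n)) :
    ∃ M U' W', U = M ++ U' ∧ W = M ++ W' ∧
      (U' = [] ∨ W' = [] ∨ ∃ g h U'' W'', g ≠ h ∧ U' = g :: U'' ∧ W' = h :: W'') := by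
  induction U generalizing W with
  | nil => exact ⟨[], [], W, rfl, rfl, Or.inl rfl⟩
  | cons g U ih =>
    rcases W with _ | ⟨h, W⟩
    · exact ⟨[], g :: U, [], rfl, rfl, Or.inr (Or.inl rfl)⟩
    · by_cases e : g = h
      · subst e
        obtain ⟨M, U', W', rfl, rfl, hh⟩ := ih W
        exact ⟨g :: M, U', W', rfl, rfl, hh⟩
      · exact ⟨[], g :: U, h :: W, rfl, rfl, Or.inr (Or.inr ⟨g, h, U, W, e, rfl, rfl⟩)⟩

/-- A polygon bounded by two descending paths from a common top vertex. -/
structure ListTile (n : ℕ) where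
  top : ℝ × ℝ
  left : List (Fin n)
  right : List (Fin n)

/-- `e` lies on the path `W` from the origin or on the left-hand side of one of the tiles. -/
def IsGoodEdge (d : Fin n → ℝ × ℝ) (W : List (Fin n)) (𝒞 : Set (ListTile n))
    (e : (ℝ × ℝ) × Fin n) : Prop :=
  e ∈ listEdges d 0 W ∨ ∃ C ∈ 𝒞, e ∈ listEdges d C.top C.left

/-- The combinatorial properties of the components of the tiles of a paw tiling with right border `W`
that allow one to push any edge path across the tiles to `W`. -/
structure IsTileComplex (d : Fin n → ℝ × ℝ) (W : List (Fin n)) (𝒞 : Set (ListTile n)) : Prop where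
  sorted : ∀ C ∈ 𝒞, C.left.Pairwise (· < ·)
  perm : ∀ C ∈ 𝒞, C.left.Perm C.right
  head_lt : ∀ C ∈ 𝒞, ∀ a L b R, C.left = a :: L → C.right = b :: R → a < b
  last_lt : ∀ C ∈ 𝒞, ∀ a L b R, C.left = L ++ [a] → C.right = R ++ [b] → b < a
  -- Only inner vertices of left halves count; an end vertex may belong to several components.
  unique : ∀ C ∈ 𝒞, ∀ C' ∈ 𝒞, ∀ A B A' B', A ≠ [] → B ≠ [] → A' ≠ [] → B' ≠ [] →
    C.left = A ++ B → C'.left = A' ++ B' → C.top + labelSum d A = C'.top + labelSum d A' → C = C'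
  not_border : ∀ C ∈ 𝒞, ∀ A B A' B', A ≠ [] → B ≠ [] → C.left = A ++ B → W = A' ++ B' →
    C.top + labelSum d A ≠ labelSum d A'
  right_good : ∀ C ∈ 𝒞, ∀ e ∈ listEdges d C.top C.right, IsGoodEdge d W 𝒞 e
  finite : {e | IsGoodEdge d W 𝒞 e}.Finite

variable {W : List (Fin n)} {𝒞 : Set (ListTile n)}

/-! ### Pushing edge paths across tiles to the right border -/

namespace IsTileComplex

/-- Follow the path down the left half of `C`. If it leaves before the end, the edge it takes must
start another component, and the search continues there with a shorter remainder; it can only stop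
at a component whose whole left half is on the path. -/
theorem exists_tile_along_of_top (hd : ∀ i, (d i).2 < 0) (h𝒞 : IsTileComplex d W 𝒞)
    {A V : List (Fin n)} (hgood : ∀ e ∈ listEdges d 0 (A ++ V), IsGoodEdge d W 𝒞 e)
    (hend : labelSum d (A ++ V) = labelSum d W) {C : ListTile n} (hC : C ∈ 𝒞)
    (htop : C.top = labelSum d A) {g : Fin n} {V' L' : List (Fin n)} (hV : V = g :: V')
    (hL : C.left = g :: L') :
    ∃ C ∈ 𝒞, ∃ A' B', A ++ V = A' ++ C.left ++ B' ∧ C.top = labelSum d A' ∧ C.left ≠ [] := by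
  induction hm : V.length using Nat.strong_induction_on generalizing A V C g V' L' with
  | _ m ih =>
    obtain ⟨M, L₁, V₁, hLM, hVM, hcase⟩ := exists_maximal_common_start C.left V
    have hMne : M ≠ [] := by
      rintro rfl
      rw [List.nil_append] at hLM hVM
      subst hLM hVM
      rcases hcase with h | h | ⟨x, y, _, _, hxy, h1, h2⟩
      · rw [hL] at h; exact absurd h (by simp)
      · rw [hV] at h; exact absurd h (by simp)
      · rw [hL] at h1
        rw [hV] at h2
        simp only [List.cons.injEq] at h1 h2
        exact hxy (h1.1.symm.trans h2.1)
    rcases Classical.em (L₁ = []) with rfl | hL₁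
    · rw [List.append_nil] at hLM
      exact ⟨C, hC, A, V₁, by rw [hVM, hLM, List.append_assoc], htop, by rw [hL]; simp⟩
    have hv : C.top + labelSum d M = labelSum d (A ++ M) := by rw [htop, labelSum_append]
    rcases hcase with h | h | ⟨f, g', L₂, V₂, hfg, h1, h2⟩
    · exact absurd h hL₁
    -- The path has reached the bottom vertex, which is on `W` and hence not an inner vertex of the
    -- left half of `C`.
    · subst h
      rw [List.append_nil] at hVM
      refine absurd ?_ (h𝒞.not_border C hC M L₁ W [] hMne hL₁ hLM (by simp))
      rw [hv, ← hVM, hend]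
    -- The edge by which the path leaves `C`. It cannot be on `W`, and `C` is the only component
    -- with this vertex inside its left half, so it is the first edge of a new component.
    · have hg' : IsGoodEdge d W 𝒞 (labelSum d (A ++ M), g') :=
        hgood _ ⟨A ++ M, V₂, by rw [hVM, h2, List.append_assoc], by simp⟩
      rcases hg' with ⟨A₂, B₂, hW, hA₂⟩ | ⟨C₂, hC₂, L₃, L₄, hC₂L, hC₂v⟩
      · refine absurd ?_ (h𝒞.not_border C hC M L₁ A₂ _ hMne hL₁ hLM hW)
        rw [hv]
        simpa using hA₂
      · simp only at hC₂L hC₂v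
        rcases Classical.em (L₃ = []) with rfl | hL₃
        · have e : A ++ M ++ V₁ = A ++ V := by rw [hVM, List.append_assoc]
          rw [← e] at hgood hend ⊢
          refine ih V₁.length ?_ hgood hend hC₂ (by simpa using hC₂v.symm) h2 hC₂L rfl
          rw [← hm, hVM, List.length_append]
          have := List.length_pos_iff.2 hMne
          omega
        · have hCC := h𝒞.unique C hC C₂ hC₂ M L₁ L₃ _ hMne hL₁ hL₃ (by simp) hLM hC₂L
            (by rw [hv, hC₂v])
          subst hCC
          rw [← hv] at hC₂v
          have := append_inj_of_labelSum hd (hLM.symm.trans hC₂L) (add_left_cancel hC₂v)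
          rw [h1] at this
          simp only [List.cons.injEq] at this
          exact absurd this.2.1 hfg

/-- A path of good edges from the origin to the bottom vertex is below `W` in the weak order. -/
theorem weakLE (hd : ∀ i, (d i).2 < 0) (h𝒞 : IsTileComplex d W 𝒞) {U : List (Fin n)}
    (hgood : ∀ e ∈ listEdges d 0 U, IsGoodEdge d W 𝒞 e) (hend : labelSum d U = labelSum d W) :
    WeakLE U W := by
  induction hm : U.length ^ 2 - invCount U using Nat.strong_induction_on generalizing U with
  | _ m ih =>
    obtain ⟨A, U', W', hU, hW, hcase⟩ := exists_maximal_common_start U W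
    rcases hcase with rfl | rfl | ⟨g, h, U₁, W₁, hgh, rfl, rfl⟩
    · rw [hU, hW, List.append_nil, labelSum_append] at hend
      rw [hU, hW, eq_nil_of_labelSum_eq_zero hd (L := W') (by simpa using hend)]
    · rw [hU, hW, List.append_nil, labelSum_append] at hend
      rw [hU, hW, eq_nil_of_labelSum_eq_zero hd (L := U') (by simpa using hend)]
    -- At this vertex `W` continues with a different edge, so this one lies on a left half; it is
    -- the first edge there, because no vertex of `W` is an inner vertex of a left half.
    have hg : IsGoodEdge d W 𝒞 (labelSum d A, g) := hgood _ ⟨A, U₁, hU, by simp⟩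
    rcases hg with ⟨A₂, B₂, hW₂, hA₂⟩ | ⟨C, hC, L₁, L₂, hCL, hCv⟩
    · have := append_inj_of_labelSum hd (hW.symm.trans hW₂) (by simpa using hA₂)
      simp only [List.cons.injEq] at this
      exact absurd this.2.1.symm hgh
    simp only at hCL hCv
    rcases Classical.em (L₁ = []) with rfl | hL₁
    · have hex := h𝒞.exists_tile_along_of_top hd (A := A) (V := g :: U₁) (hU ▸ hgood) (hU ▸ hend)
        hC (by simpa using hCv.symm) rfl hCL
      rw [← hU] at hex
      obtain ⟨C', hC', A', B', hU', htop, hne⟩ := hex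
      have hle := WeakLE.context (weakLE_of_pairwise_lt (h𝒞.sorted C' hC') (h𝒞.perm C' hC')) A' B'
      have hneq : A' ++ C'.left ++ B' ≠ A' ++ C'.right ++ B' := by
        intro e
        have e' : C'.left = C'.right := by simpa using e
        obtain ⟨x, X, hx⟩ := List.exists_cons_of_ne_nil hne
        exact lt_irrefl _ (h𝒞.head_lt C' hC' x X x X hx (e' ▸ hx))
      have hlt := WeakLE.invCount_lt hle hneq
      have hsq := invCount_le_sq (A' ++ C'.right ++ B')
      have hlen := (WeakLE.perm hle).length_eq
      subst hU'
      -- Crossing the tile is a strict rise in the weak order, and the new edges are good by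
      -- `right_good`.
      refine Relation.ReflTransGen.trans hle (ih _ ?_ ?_ ?_ rfl)
      · rw [← hlen] at hsq ⊢
        omega
      · intro e he
        have hsum := labelSum_perm (d := d) (h𝒞.perm C' hC')
        rw [listEdges_append, listEdges_append] at he
        rcases he with (he | he) | he
        · exact hgood e (by rw [listEdges_append, listEdges_append]; exact Or.inl (Or.inl he))
        · rw [zero_add, ← htop] at he
          exact h𝒞.right_good C' hC' e he
        · refine hgood e ?_
          rw [listEdges_append]
          refine Or.inr ?_
          rw [labelSum_append, ← hsum, ← labelSum_append] at he
          exact he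
      · rw [← hend]
        exact (labelSum_perm (WeakLE.perm hle)).symm
    · exact absurd hCv.symm (h𝒞.not_border C hC L₁ _ A _ hL₁ (by simp) hCL hW)

/-- If the edge starts a left half, replace it by the first edge of the right half, which is good,
has the same upper vertex and a larger label. Labels are bounded, so eventually the edge has a
predecessor on its path. -/
theorem exists_good_edge_above (h𝒞 : IsTileComplex d W 𝒞) {v : ℝ × ℝ}
    (hv : v ≠ 0) {a : Fin n} (h : IsGoodEdge d W 𝒞 (v, a)) :
    ∃ v' a', IsGoodEdge d W 𝒞 (v', a') ∧ v' + d a' = v := by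
  induction hm : n - (a : ℕ) using Nat.strong_induction_on generalizing a with
  | _ m ih =>
    rcases h with ⟨A, B, hW, hA⟩ | ⟨C, hC, A, B, hL, hA⟩
    · rcases List.eq_nil_or_concat' A with rfl | ⟨A', a', rfl⟩
      · exact absurd (by simpa using hA) hv
      · refine ⟨labelSum d A', a', Or.inl ⟨A', a :: B, by simpa using hW, by simp⟩, ?_⟩
        simpa using hA.symm
    · rcases List.eq_nil_or_concat' A with rfl | ⟨A', a', rfl⟩
      · have hp := h𝒞.perm C hC
        simp only [List.nil_append] at hL
        rcases hR : C.right with _ | ⟨b, R⟩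
        · rw [hL, hR] at hp
          exact absurd hp.length_eq (by simp)
        · have hab := h𝒞.head_lt C hC a B b R hL hR
          refine ih _ ?_ (h𝒞.right_good C hC (v, b) ⟨[], R, hR, by simpa using hA⟩) rfl
          have : (a : ℕ) < b := hab
          omega
      · refine ⟨C.top + labelSum d A', a',
          Or.inr ⟨C, hC, A', a :: B, by simpa using hL, rfl⟩, ?_⟩
        simpa [add_assoc] using hA.symm

/-- The mirror argument: the last edge of a left half is replaced by the last edge of the right
half, with the same lower vertex and a smaller label. -/
theorem exists_good_edge_below (h𝒞 : IsTileComplex d W 𝒞) {v : ℝ × ℝ}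
    {a : Fin n} (h : IsGoodEdge d W 𝒞 (v, a)) (hv : v + d a ≠ labelSum d W) :
    ∃ a', IsGoodEdge d W 𝒞 (v + d a, a') := by
  induction hm : (a : ℕ) using Nat.strong_induction_on generalizing v a with
  | _ m ih =>
    rcases h with ⟨A, B, hW, hA⟩ | ⟨C, hC, A, B, hL, hA⟩
    · simp only at hW hA
      rcases B with _ | ⟨a', B⟩
      · refine absurd ?_ hv
        rw [hW, hA]
        simp
      · exact ⟨a', Or.inl ⟨A ++ [a], B, by simpa using hW, by simp [hA]⟩⟩
    · simp only at hL hA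
      rcases B with _ | ⟨a', B⟩
      · have hp := h𝒞.perm C hC
        rcases List.eq_nil_or_concat' C.right with hR | ⟨R, b, hR⟩
        · rw [hL, hR] at hp
          exact absurd hp.length_eq (by simp)
        · have hba := h𝒞.last_lt C hC a A b R hL hR
          have hsum := labelSum_perm (d := d) hp
          rw [hL, hR] at hsum
          simp only [labelSum_append, labelSum_cons, labelSum_nil, add_zero] at hsum
          have e : v + d a = C.top + labelSum d R + d b := by
            rw [hA, add_assoc, hsum, add_assoc]
          rw [e] at hv ⊢
          exact ih b (hm ▸ hba)
            (h𝒞.right_good C hC (C.top + labelSum d R, b) ⟨R, [], hR, rfl⟩) hv rfl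
      · exact ⟨a', Or.inr ⟨C, hC, A ++ [a], B, by simpa using hL, by simp [hA, add_assoc]⟩⟩

theorem exists_path_above (hd : ∀ i, (d i).2 < 0) (h𝒞 : IsTileComplex d W 𝒞)
    {e : (ℝ × ℝ) × Fin n} (h : IsGoodEdge d W 𝒞 e) :
    ∃ A, labelSum d A = e.1 ∧ ∀ e' ∈ listEdges d 0 A, IsGoodEdge d W 𝒞 e' := by
  -- There are finitely many good edges, so climbing from edge to edge terminates.
  have hwf : {e | IsGoodEdge d W 𝒞 e}.WellFoundedOn
      (InvImage (· > ·) fun e : (ℝ × ℝ) × Fin n => e.1.2) := by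
    have : Std.Irrefl (InvImage (· > ·) fun e : (ℝ × ℝ) × Fin n => e.1.2) :=
      ⟨fun e h => lt_irrefl _ h⟩
    have : IsTrans _ (InvImage (· > ·) fun e : (ℝ × ℝ) × Fin n => e.1.2) :=
      ⟨fun _ _ _ h h' => lt_trans h' h⟩
    have : IsStrictOrder _ (InvImage (· > ·) fun e : (ℝ × ℝ) × Fin n => e.1.2) := {}
    exact h𝒞.finite.wellFoundedOn
  refine hwf.induction (P := fun e => ∃ A, labelSum d A = e.1 ∧
    ∀ e' ∈ listEdges d 0 A, IsGoodEdge d W 𝒞 e') h ?_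
  intro e he ih
  obtain ⟨v, a⟩ := e
  by_cases hv : v = 0
  · exact ⟨[], by simp [hv], by simp⟩
  · obtain ⟨v', a', h', rfl⟩ := h𝒞.exists_good_edge_above hv he
    obtain ⟨A, hA, hgood⟩ := ih (v', a') h' (by
      simp only [InvImage, Prod.snd_add]
      linarith [hd a'])
    simp only at hA
    refine ⟨A ++ [a'], by simp [hA], ?_⟩
    intro e he
    rw [listEdges_append, listEdges_cons, listEdges_nil, Set.union_empty] at he
    rcases he with he | he
    · exact hgood e he
    · rw [Set.mem_singleton_iff.1 he, zero_add, hA]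
      exact h'

theorem exists_path_below (hd : ∀ i, (d i).2 < 0) (h𝒞 : IsTileComplex d W 𝒞)
    {e : (ℝ × ℝ) × Fin n} (h : IsGoodEdge d W 𝒞 e) :
    ∃ B, e.1 + d e.2 + labelSum d B = labelSum d W ∧
      ∀ e' ∈ listEdges d (e.1 + d e.2) B, IsGoodEdge d W 𝒞 e' := by
  have hwf : {e | IsGoodEdge d W 𝒞 e}.WellFoundedOn
      (InvImage (· < ·) fun e : (ℝ × ℝ) × Fin n => e.1.2) := by
    have : Std.Irrefl (InvImage (· < ·) fun e : (ℝ × ℝ) × Fin n => e.1.2) :=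
      ⟨fun e h => lt_irrefl _ h⟩
    have : IsTrans _ (InvImage (· < ·) fun e : (ℝ × ℝ) × Fin n => e.1.2) :=
      ⟨fun _ _ _ h h' => lt_trans h h'⟩
    have : IsStrictOrder _ (InvImage (· < ·) fun e : (ℝ × ℝ) × Fin n => e.1.2) := {}
    exact h𝒞.finite.wellFoundedOn
  refine hwf.induction (P := fun e => ∃ B, e.1 + d e.2 + labelSum d B = labelSum d W ∧
    ∀ e' ∈ listEdges d (e.1 + d e.2) B, IsGoodEdge d W 𝒞 e') h ?_
  intro e he ih
  obtain ⟨v, a⟩ := e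
  simp only
  by_cases hv : v + d a = labelSum d W
  · exact ⟨[], by simp [hv], by simp⟩
  · obtain ⟨a', h'⟩ := h𝒞.exists_good_edge_below he hv
    obtain ⟨B, hB, hgood⟩ := ih (v + d a, a') h' (by
      simp only [InvImage, Prod.snd_add]
      linarith [hd a])
    simp only at hB hgood
    refine ⟨a' :: B, by rw [labelSum_cons, ← add_assoc, hB], ?_⟩
    intro e he
    rw [listEdges_cons] at he
    rcases he with he | he
    · rw [Set.mem_singleton_iff.1 he]
      exact h'
    · exact hgood e he

/-- Every nonempty path of good edges is part of a path below `W` in the weak order. -/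
theorem exists_weakLE (hd : ∀ i, (d i).2 < 0) (h𝒞 : IsTileComplex d W 𝒞) {t : ℝ × ℝ}
    {R : List (Fin n)} (hR : R ≠ []) (hgood : ∀ e ∈ listEdges d t R, IsGoodEdge d W 𝒞 e) :
    ∃ A B, labelSum d A = t ∧ WeakLE (A ++ R ++ B) W := by
  obtain ⟨a, R', ha⟩ := List.exists_cons_of_ne_nil hR
  obtain ⟨A, hA, hAg⟩ := h𝒞.exists_path_above hd (hgood (t, a) ⟨[], R', ha, by simp⟩)
  obtain ⟨b, R'', hb⟩ : ∃ b R'', R = R'' ++ [b] := by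
    rcases List.eq_nil_or_concat' R with h | ⟨R'', b, h⟩
    · exact absurd h hR
    · exact ⟨b, R'', h⟩
  obtain ⟨B, hB, hBg⟩ := h𝒞.exists_path_below hd (hgood (t + labelSum d R'', b) ⟨R'', [], hb, rfl⟩)
  simp only at hA hB hBg
  have e : t + labelSum d R'' + d b = t + labelSum d R := by rw [hb]; simp [add_assoc]
  rw [e] at hB hBg
  refine ⟨A, B, hA, h𝒞.weakLE hd ?_ (by rw [labelSum_append, labelSum_append, hA, hB])⟩
  intro e he
  rw [listEdges_append, listEdges_append, labelSum_append, zero_add, hA, zero_add] at he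
  rcases he with (he | he) | he
  · exact hAg e he
  · exact hgood e he
  · exact hBg e he

end IsTileComplex

end LabelPaths

/-! ### The horizontal position along a descending path -/

section Travel

variable {α : Type*} {σ η : α → ℝ}

/-- The horizontal displacement at depth `s` along a path whose edges `a` have the height `η a` and the
horizontal displacement `σ a` per unit of depth. -/
noncomputable def travel (σ η : α → ℝ) : List α → ℝ → ℝ
  | [], _ => 0
  | a :: L, s => σ a * max 0 (min s (η a)) + travel σ η L (s - η a)

/-- The total height of a path. -/
def totalHeight (η : α → ℝ) (L : List α) : ℝ :=
  (L.map η).sum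

@[simp]
theorem totalHeight_nil : totalHeight η [] = 0 := rfl

@[simp]
theorem totalHeight_cons (a : α) (L : List α) :
    totalHeight η (a :: L) = η a + totalHeight η L := by
  simp [totalHeight]

@[simp]
theorem totalHeight_append (A B : List α) :
    totalHeight η (A ++ B) = totalHeight η A + totalHeight η B := by
  simp [totalHeight]

theorem totalHeight_perm {L R : List α} (h : L.Perm R) : totalHeight η L = totalHeight η R :=
  (h.map η).sum_eq

theorem totalHeight_nonneg (hη : ∀ a, 0 < η a) (L : List α) : 0 ≤ totalHeight η L := by
  induction L with
  | nil => simp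
  | cons a L ih => rw [totalHeight_cons]; linarith [hη a]

theorem totalHeight_pos (hη : ∀ a, 0 < η a) {L : List α} (hL : L ≠ []) : 0 < totalHeight η L := by
  cases L with
  | nil => exact absurd rfl hL
  | cons a L => rw [totalHeight_cons]; linarith [hη a, totalHeight_nonneg hη L]

theorem continuous_travel (L : List α) : Continuous (travel σ η L) := by
  induction L with
  | nil => exact continuous_const
  | cons a L ih =>
    simp only [travel]
    fun_prop

theorem travel_of_nonpos (hη : ∀ a, 0 < η a) (L : List α) {s : ℝ} (hs : s ≤ 0) :
    travel σ η L s = 0 := by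
  induction L generalizing s with
  | nil => rfl
  | cons a L ih =>
    have h1 : min s (η a) = s := min_eq_left (by linarith [hη a])
    rw [travel, h1, max_eq_left hs, ih (by linarith [hη a])]
    simp

theorem travel_append (A B : List α) (s : ℝ) :
    travel σ η (A ++ B) s = travel σ η A s + travel σ η B (s - totalHeight η A) := by
  induction A generalizing s with
  | nil => simp [travel]
  | cons a A ih =>
    simp only [List.cons_append, travel, ih, totalHeight_cons, sub_sub]
    ring

theorem travel_of_totalHeight_le (hη : ∀ a, 0 < η a) (L : List α) {s : ℝ}
    (hs : totalHeight η L ≤ s) : travel σ η L s = (L.map fun a => σ a * η a).sum := by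
  induction L generalizing s with
  | nil => rfl
  | cons a L ih =>
    rw [totalHeight_cons] at hs
    have h0 := totalHeight_nonneg hη L
    rw [travel, ih (by linarith), min_eq_right (by linarith), max_eq_right (hη a).le]
    simp

theorem travel_one (hη : ∀ a, 0 < η a) (L : List α) {s : ℝ} (h0 : 0 ≤ s)
    (hs : s ≤ totalHeight η L) : travel 1 η L s = s := by
  induction L generalizing s with
  | nil =>
    rw [totalHeight_nil] at hs
    simp [travel, le_antisymm hs h0]
  | cons a L ih =>
    rw [totalHeight_cons] at hs
    rcases le_total s (η a) with h | h
    · rw [travel, travel_of_nonpos hη L (by linarith), min_eq_left h, max_eq_right h0]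
      simp
    · rw [travel, ih (by linarith) (by linarith), min_eq_right h, max_eq_right (hη a).le]
      simp

/-- A shear: within the height of a path `travel 1` is the depth (`travel_one`), so all paths of
that height are moved equally. -/
theorem travel_sub_const (c : ℝ) (L : List α) (s : ℝ) :
    travel (fun a => σ a - c) η L s = travel σ η L s - c * travel 1 η L s := by
  induction L generalizing s with
  | nil => simp [travel]
  | cons a L ih =>
    simp only [travel, ih, Pi.one_apply]
    ring

/-- Down to any depth the two orders traverse the same total height of `a` and `b` (`h1`), but the
order with `b` first traverses at least as much of the steeper-to-the-right edge `b` (`h2`). -/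
theorem travel_swap_le (hη : ∀ a, 0 < η a) {a b : α} (hab : σ a ≤ σ b) (B : List α) (s : ℝ) :
    travel σ η (a :: b :: B) s ≤ travel σ η (b :: a :: B) s := by
  have ha := hη a
  have hb := hη b
  have e : s - η a - η b = s - η b - η a := by ring
  simp only [travel, e]
  have h1 : max 0 (min s (η a)) + max 0 (min (s - η a) (η b)) =
      max 0 (min s (η b)) + max 0 (min (s - η b) (η a)) := by
    simp only [max_def, min_def]
    split_ifs <;> linarith
  have h2 : max 0 (min (s - η a) (η b)) ≤ max 0 (min s (η b)) :=
    max_le_max le_rfl (min_le_min (by linarith) le_rfl)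
  generalize max 0 (min s (η a)) = p₁ at *
  generalize max 0 (min (s - η a) (η b)) = p₂ at *
  generalize max 0 (min s (η b)) = q₁ at *
  generalize max 0 (min (s - η b) (η a)) = q₂ at *
  obtain rfl : q₂ = p₁ + p₂ - q₁ := by linarith
  nlinarith [mul_nonneg (sub_nonneg.2 hab) (sub_nonneg.2 h2)]

/-- The deficit of a path against the supporting line of slope `c`. -/
theorem travel_add_sum_nonneg (hη : ∀ a, 0 < η a) (c : ℝ) (R : List α) (s : ℝ) :
    0 ≤ travel (fun a => σ a - c) η R s + (R.map fun a => max 0 (c - σ a) * η a).sum := by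
  induction R generalizing s with
  | nil => simp [travel]
  | cons a R ih =>
    have h1 := ih (s - η a)
    have h2 : 0 ≤ (σ a - c) * max 0 (min s (η a)) + max 0 (c - σ a) * η a := by
      have ha := (hη a).le
      have h3 : max 0 (min s (η a)) ≤ η a := max_le ha (min_le_right _ _)
      have h4 : 0 ≤ max 0 (min s (η a)) := le_max_left _ _
      generalize max 0 (min s (η a)) = q at h3 h4 ⊢
      rcases le_total c (σ a) with h | h
      · rw [max_eq_left (by linarith)]
        have := mul_nonneg (sub_nonneg.2 h) h4
        linarith
      · rw [max_eq_right (by linarith)]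
        nlinarith [mul_nonneg (sub_nonneg.2 h) (sub_nonneg.2 h3)]
    simp only [travel, List.map_cons, List.sum_cons]
    linarith

/-- The quantity is a sum of nonnegative contributions of the edges, so each vanishes. An edge at
least partly traversed then cannot have slope above `c`, and one not fully traversed cannot have
slope below `c`. -/
theorem slope_bounds_of_travel_add_sum_nonpos (hη : ∀ a, 0 < η a) (c : ℝ) {R : List α} {s : ℝ}
    (h : travel (fun a => σ a - c) η R s + (R.map fun a => max 0 (c - σ a) * η a).sum ≤ 0)
    {A B : List α} {b : α} (hR : R = A ++ b :: B) :
    (totalHeight η A < s → σ b ≤ c) ∧ (s < totalHeight η A + η b → c ≤ σ b) := by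
  subst hR
  induction A generalizing s with
  | nil =>
    have h1 := travel_add_sum_nonneg (σ := σ) hη c B (s - η b)
    simp only [List.nil_append, travel, List.map_cons, List.sum_cons] at h
    have hb := hη b
    simp only [totalHeight_nil, zero_add]
    constructor
    · intro hs
      by_contra hc
      push Not at hc
      rw [max_eq_left (a := 0) (b := c - σ b) (by linarith)] at h
      have : 0 < max 0 (min s (η b)) := lt_max_of_lt_right (lt_min hs hb)
      nlinarith [mul_pos (sub_pos.2 hc) this]
    · intro hs
      by_contra hc
      push Not at hc
      rw [max_eq_right (a := 0) (b := c - σ b) (by linarith)] at h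
      have : max 0 (min s (η b)) < η b := max_lt hb (min_lt_of_left_lt hs)
      nlinarith [mul_pos (sub_pos.2 hc) (sub_pos.2 this)]
  | cons a A ih =>
    have h1 := travel_add_sum_nonneg (σ := σ) hη c [a] s
    simp only [travel, List.map_cons, List.sum_cons, List.map_nil, List.sum_nil, add_zero] at h1
    simp only [List.cons_append, travel, List.map_cons, List.sum_cons] at h
    have := ih (s := s - η a) (by linarith)
    rw [totalHeight_cons]
    exact ⟨fun hs => this.1 (by linarith), fun hs => this.2 (by linarith)⟩

/-- A path with increasing slopes attains the bound of the supporting line. -/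
theorem travel_add_sum_eq_zero (hη : ∀ a, 0 < η a) {c s : ℝ} {A B : List α}
    (hA : ∀ a ∈ A, σ a ≤ c) (hB : ∀ b ∈ B, c ≤ σ b) (hs : totalHeight η A ≤ s)
    (h0 : travel (fun a => σ a - c) η B (s - totalHeight η A) = 0) :
    travel (fun a => σ a - c) η (A ++ B) s +
      ((A ++ B).map fun a => max 0 (c - σ a) * η a).sum = 0 := by
  rw [travel_append, h0, travel_of_totalHeight_le hη A hs, List.map_append, List.sum_append]
  have h1 : (B.map fun a => max 0 (c - σ a) * η a).sum = 0 := by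
    apply List.sum_eq_zero
    intro x hx
    obtain ⟨b, hb, rfl⟩ := List.mem_map.1 hx
    rw [max_eq_left (by linarith [hB b hb]), zero_mul]
  have h2 : (A.map fun a => max 0 (c - σ a) * η a) = A.map fun a => -((σ a - c) * η a) := by
    apply List.map_congr_left
    intro a ha
    rw [max_eq_right (by linarith [hA a ha])]
    ring
  have h3 : (A.map fun a => -((σ a - c) * η a)).sum = -(A.map fun a => (σ a - c) * η a).sum := by
    clear hA h2 hs h0 h1
    induction A with
    | nil => simp
    | cons a A ih => simp only [List.map_cons, List.sum_cons, ih]; ring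
  rw [h1, h2, h3]
  ring

/-- Both the sum and the shear term at depth `s` are unchanged by rearrangement, so equality in the
supporting-line bound passes from `L` to any rearrangement not to its right. -/
theorem travel_add_sum_nonpos_of_le (hη : ∀ a, 0 < η a) {c s : ℝ} {L R : List α} (hp : L.Perm R)
    (h0 : 0 ≤ s) (hs : s ≤ totalHeight η L)
    (hL : travel (fun a => σ a - c) η L s + (L.map fun a => max 0 (c - σ a) * η a).sum = 0)
    (hle : travel σ η R s ≤ travel σ η L s) :
    travel (fun a => σ a - c) η R s + (R.map fun a => max 0 (c - σ a) * η a).sum ≤ 0 := by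
  rw [← (hp.map _).sum_eq]
  rw [travel_sub_const, travel_one hη _ h0 (by rwa [← totalHeight_perm hp])]
  rw [travel_sub_const, travel_one hη _ h0 hs] at hL
  linarith

/-- If a rearrangement `R` of a path `A ++ B` with increasing slopes is not strictly to its right at the
end of `A`, then it also reaches that vertex. -/
theorem exists_perm_prefix_of_travel_le (hη : ∀ a, 0 < η a) {A B R : List α}
    (hsort : ∀ a ∈ A, ∀ b ∈ B, σ a < σ b) (hp : (A ++ B).Perm R)
    (hle : travel σ η R (totalHeight η A) ≤ travel σ η (A ++ B) (totalHeight η A)) :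
    ∃ R₁ R₂, R = R₁ ++ R₂ ∧ R₁.Perm A := by
  classical
  -- A line of slope `c` supports the path `A ++ B` at the end of `A` only.
  obtain ⟨c, hcA, hcB⟩ := Order.exists_between_finsets
    (lo := (A.map σ).toFinset) (hi := (B.map σ).toFinset) (by simpa using hsort)
  simp only [List.mem_toFinset, List.mem_map, forall_exists_index, and_imp,
    forall_apply_eq_imp_iff₂] at hcA hcB
  have hL := travel_add_sum_eq_zero (σ := σ) hη (c := c) (s := totalHeight η A) (A := A) (B := B)
    (fun a ha => (hcA a ha).le) (fun b hb => (hcB b hb).le) le_rfl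
    (by rw [sub_self]; exact travel_of_nonpos hη _ le_rfl)
  have hR := travel_add_sum_nonpos_of_le hη hp (totalHeight_nonneg hη A)
    (by rw [totalHeight_append]; linarith [totalHeight_nonneg hη B]) hL hle
  have hbd := fun {X Y : List α} {b : α} => slope_bounds_of_travel_add_sum_nonpos hη c hR
    (A := X) (B := Y) (b := b)
  have hne : ∀ x ∈ R, σ x < c ∨ c < σ x := by
    intro x hx
    rcases List.mem_append.1 (hp.symm.subset hx) with h | h
    · exact Or.inl (hcA x h)
    · exact Or.inr (hcB x h)
  let p : α → Bool := fun a => decide (σ a < c)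
  refine ⟨R.takeWhile p, R.dropWhile p, List.takeWhile_append_dropWhile.symm, ?_⟩
  have hsplit : R = R.takeWhile p ++ R.dropWhile p := List.takeWhile_append_dropWhile.symm
  have h1 : (R.takeWhile p).filter p = R.takeWhile p :=
    List.filter_eq_self.2 fun a ha => List.mem_takeWhile_imp ha
  have h2 : (R.dropWhile p).filter p = [] := by
    rcases hd : R.dropWhile p with _ | ⟨b, D⟩
    · rfl
    rw [hd] at hsplit
    have hb : ¬ σ b < c := by
      have := List.head_dropWhile_not p (l := R) (by rw [hd]; simp)
      simpa [hd, p] using this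
    have hbR : b ∈ R := by rw [hsplit]; simp
    have hbc : c < σ b := (hne b hbR).resolve_left hb
    -- The first edge `b` of slope above `c` cannot start above the depth of `A`; all later edges
    -- end below that depth and so have slope at least `c`.
    have hs : totalHeight η A ≤ totalHeight η (R.takeWhile p) := by
      by_contra h
      push Not at h
      linarith [(hbd hsplit).1 h]
    rw [List.filter_eq_nil_iff]
    intro x hx
    simp only [p, decide_eq_true_eq, not_lt]
    rcases List.mem_cons.1 hx with rfl | hx
    · exact hbc.le
    · obtain ⟨D₁, D₂, rfl⟩ := List.append_of_mem hx
      refine (hbd (X := R.takeWhile p ++ b :: D₁) (Y := D₂) (b := x) (by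
        rw [List.append_assoc]; exact hsplit)).2 ?_
      rw [totalHeight_append, totalHeight_cons]
      linarith [hη b, hη x, totalHeight_nonneg hη D₁]
  have h3 : R.filter p = R.takeWhile p := by
    conv_lhs => rw [hsplit]
    rw [List.filter_append, h1, h2, List.append_nil]
  have h4 : (A ++ B).filter p = A := by
    rw [List.filter_append, List.filter_eq_self.2 (fun a ha => by simp [p, hcA a ha]),
      List.filter_eq_nil_iff.2 (fun b hb => by simp [p, (hcB b hb).le]), List.append_nil]
  rw [← h3]
  conv_rhs => rw [← h4]
  exact (hp.filter p).symm

/-- A rearrangement of a path with increasing slopes is strictly to its right at a vertex above which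
an edge has a larger slope than some edge below. -/
theorem travel_lt_of_descent (hη : ∀ a, 0 < η a) {L A B : List α} {x y : α}
    (hsort : L.Pairwise fun a b => σ a < σ b) (hp : L.Perm (A ++ B)) (hx : x ∈ A) (hy : y ∈ B)
    (hxy : σ y < σ x) :
    travel σ η L (totalHeight η A) < travel σ η (A ++ B) (totalHeight η A) := by
  by_contra hle
  push Not at hle
  have h0 := totalHeight_nonneg hη A
  have hBpos := totalHeight_pos hη (List.ne_nil_of_mem hy)
  have hs : totalHeight η A < totalHeight η L := by
    rw [totalHeight_perm hp, totalHeight_append]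
    linarith
  -- `e` is the edge of `L` met at the depth of `A`; its slope is used as the slope `c` of the
  -- supporting line.
  obtain ⟨L₁, e, L₂, hL, h1, h2⟩ : ∃ L₁ e L₂, L = L₁ ++ e :: L₂ ∧
      totalHeight η L₁ ≤ totalHeight η A ∧ totalHeight η A < totalHeight η L₁ + η e := by
    clear hle hsort hp hBpos
    generalize totalHeight η A = s at *
    induction L generalizing s with
    | nil => rw [totalHeight_nil] at hs; linarith
    | cons e L ih =>
      rcases lt_or_ge s (η e) with h | h
      · exact ⟨[], e, L, rfl, by simpa using h0, by simpa using h⟩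
      · rw [totalHeight_cons] at hs
        obtain ⟨L₁, e', L₂, rfl, h1, h2⟩ := ih (s - η e) (by linarith) (by linarith)
        exact ⟨e :: L₁, e', L₂, rfl, by rw [totalHeight_cons]; linarith,
          by rw [totalHeight_cons]; linarith⟩
  rw [hL, List.pairwise_append, List.pairwise_cons] at hsort
  have hz : travel (fun a => σ a - σ e) η (e :: L₂) (totalHeight η A - totalHeight η L₁) = 0 := by
    rw [travel, travel_of_nonpos hη _ (by linarith)]
    simp
  have hLz := travel_add_sum_eq_zero (σ := σ) hη (c := σ e) (A := L₁) (B := e :: L₂)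
    (fun a ha => (hsort.2.2 a ha e (by simp)).le)
    (fun b hb => by
      rcases List.mem_cons.1 hb with rfl | hb
      · exact le_rfl
      · exact (hsort.2.1.1 b hb).le) h1 hz
  rw [← hL] at hLz
  have hR := travel_add_sum_nonpos_of_le hη hp h0 hs.le hLz hle
  obtain ⟨A₁, A₂, rfl⟩ := List.append_of_mem hx
  obtain ⟨B₁, B₂, rfl⟩ := List.append_of_mem hy
  -- Since `x` lies above the depth in question and `y` below it, `σ x ≤ σ e ≤ σ y`, against `σ y <
  -- σ x`.
  have b1 := (slope_bounds_of_travel_add_sum_nonpos hη (σ e) hR (A := A₁)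
    (B := A₂ ++ (B₁ ++ y :: B₂)) (b := x) (by simp)).1 (by
      rw [totalHeight_append, totalHeight_cons]
      linarith [hη x, totalHeight_nonneg hη A₂])
  have b2 := (slope_bounds_of_travel_add_sum_nonpos hη (σ e) hR (A := A₁ ++ x :: A₂ ++ B₁)
    (B := B₂) (b := y) (by simp)).2 (by
      rw [totalHeight_append (A₁ ++ x :: A₂)]
      linarith [hη y, totalHeight_nonneg hη B₁])
  linarith

end Travel

/-! ### The region of an Elnitsky polygon in coordinates -/

section Region

variable {n : ℕ} {d : Fin n → ℝ × ℝ}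

/-- Horizontal displacement per unit of depth along an edge. -/
noncomputable def edgeSlope (d : Fin n → ℝ × ℝ) (a : Fin n) : ℝ :=
  (d a).1 / -(d a).2

/-- The height of an edge. -/
def edgeHeight (d : Fin n → ℝ × ℝ) (a : Fin n) : ℝ :=
  -(d a).2

/-- The horizontal displacement at depth `s` along the path with the labels `L`. -/
noncomputable abbrev xAt (d : Fin n → ℝ × ℝ) (L : List (Fin n)) (s : ℝ) : ℝ :=
  travel (edgeSlope d) (edgeHeight d) L s

/-- The height of the path with the labels `L`. -/
abbrev depth (d : Fin n → ℝ × ℝ) (L : List (Fin n)) : ℝ :=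
  totalHeight (edgeHeight d) L

theorem IsEdgeSystem.edgeHeight_pos (hd : IsEdgeSystem d) (a : Fin n) : 0 < edgeHeight d a :=
  neg_pos.2 (hd.down a)

/-- The counterclockwise condition divided by the two positive heights. -/
theorem IsEdgeSystem.edgeSlope_strictMono (hd : IsEdgeSystem d) : StrictMono (edgeSlope d) := by
  intro a b hab
  have ha := hd.edgeHeight_pos a
  have hb := hd.edgeHeight_pos b
  have h := hd.ccw a b hab
  unfold edgeSlope
  unfold edgeHeight at ha hb
  rw [div_lt_div_iff₀ ha hb]
  linarith

theorem IsEdgeSystem.edgeSlope_mul_edgeHeight (hd : IsEdgeSystem d) (a : Fin n) :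
    edgeSlope d a * edgeHeight d a = (d a).1 :=
  div_mul_cancel₀ _ (hd.edgeHeight_pos a).ne'

theorem depth_eq (L : List (Fin n)) : depth d L = -(labelSum d L).2 := by
  induction L with
  | nil => simp
  | cons a L ih => simp only [totalHeight_cons, ih, labelSum_cons, Prod.snd_add, edgeHeight]; ring

theorem xAt_of_depth_le (hd : IsEdgeSystem d) {L : List (Fin n)} {s : ℝ} (hs : depth d L ≤ s) :
    xAt d L s = (labelSum d L).1 := by
  rw [xAt, travel_of_totalHeight_le hd.edgeHeight_pos L hs]
  clear hs
  induction L with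
  | nil => simp
  | cons a L ih =>
    rw [List.map_cons, List.sum_cons, ih, hd.edgeSlope_mul_edgeHeight, labelSum_cons, Prod.fst_add]

theorem xAt_append_of_depth (hd : IsEdgeSystem d) (A B : List (Fin n)) :
    xAt d (A ++ B) (depth d A) = (labelSum d A).1 := by
  rw [xAt, travel_append, sub_self, travel_of_nonpos hd.edgeHeight_pos _ le_rfl, add_zero,
    ← xAt, xAt_of_depth_le hd le_rfl]

/-- The label placed first has the larger slope, so the swap bends the path to the right. -/
theorem SwapStep.xAt_le (hd : IsEdgeSystem d) {U V : List (Fin n)} (h : SwapStep U V) (s : ℝ) :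
    xAt d U s ≤ xAt d V s := by
  obtain ⟨A, B, a, b, hab, rfl, rfl⟩ := h
  rw [xAt, xAt, travel_append, travel_append]
  have := travel_swap_le hd.edgeHeight_pos (hd.edgeSlope_strictMono hab).le B
    (s - totalHeight (edgeHeight d) A)
  linarith

theorem WeakLE.xAt_le (hd : IsEdgeSystem d) {U V : List (Fin n)} (h : WeakLE U V) (s : ℝ) :
    xAt d U s ≤ xAt d V s := by
  induction h with
  | refl => exact le_rfl
  | tail _ h ih => exact ih.trans (h.xAt_le hd s)

theorem pathVertex_zero {k : ℕ} (t : ℝ × ℝ) (f : Fin k → Fin n) : pathVertex d t f 0 = t := by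
  simp [pathVertex]

theorem pathVertex_succ {k : ℕ} (t : ℝ × ℝ) (f : Fin (k + 1) → Fin n) (j : ℕ) :
    pathVertex d t f (j + 1) = pathVertex d (t + d (f 0)) (fun i => f i.succ) j := by
  simp only [pathVertex, Finset.sum_filter, Fin.sum_univ_succ, Fin.val_zero, Fin.val_succ,
    Nat.zero_lt_succ, if_true, Nat.add_lt_add_iff_right, add_assoc]

theorem pathEdges_eq_listEdges {k : ℕ} (t : ℝ × ℝ) (f : Fin k → Fin n) :
    pathEdges d t f = listEdges d t (List.ofFn f) := by
  induction k generalizing t with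
  | zero => ext e; simp [pathEdges]
  | succ k ih =>
    rw [List.ofFn_succ, listEdges_cons, ← ih]
    ext e
    simp only [pathEdges, Set.mem_range, Fin.exists_fin_succ, Fin.val_zero, pathVertex_zero,
      Fin.val_succ, pathVertex_succ, Set.mem_union, Set.mem_singleton_iff, eq_comm]

theorem mem_segment_edge_iff (hd : IsEdgeSystem d) (t : ℝ × ℝ) (a : Fin n) (z : ℝ × ℝ) :
    z ∈ segment ℝ t (t + d a) ↔ 0 ≤ t.2 - z.2 ∧ t.2 - z.2 ≤ edgeHeight d a ∧
      z.1 = t.1 + edgeSlope d a * (t.2 - z.2) := by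
  have ha := hd.edgeHeight_pos a
  have hs := hd.edgeSlope_mul_edgeHeight a
  have h2 : (d a).2 = -edgeHeight d a := by simp [edgeHeight]
  rw [segment_eq_image']
  constructor
  · rintro ⟨θ, ⟨h0, h1⟩, rfl⟩
    simp only [add_sub_cancel_left, Prod.snd_add, Prod.smul_snd, smul_eq_mul, Prod.fst_add,
      Prod.smul_fst, h2, ← hs]
    refine ⟨?_, ?_, ?_⟩
    · nlinarith
    · nlinarith
    · ring
  · rintro ⟨h0, h1, h3⟩
    refine ⟨(t.2 - z.2) / edgeHeight d a, ⟨div_nonneg h0 ha.le, (div_le_one ha).2 h1⟩, ?_⟩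
    ext
    · simp only [add_sub_cancel_left, Prod.fst_add, Prod.smul_fst, smul_eq_mul, ← hs, h3]
      field_simp
    · simp only [add_sub_cancel_left, Prod.snd_add, Prod.smul_snd, smul_eq_mul, h2]
      field_simp
      ring

theorem mem_listTrace_iff (hd : IsEdgeSystem d) (t : ℝ × ℝ) (L : List (Fin n)) (z : ℝ × ℝ) :
    (z ∈ {t} ∪ ⋃ e ∈ listEdges d t L, segment ℝ e.1 (e.1 + d e.2)) ↔
      0 ≤ t.2 - z.2 ∧ t.2 - z.2 ≤ depth d L ∧ z.1 = t.1 + xAt d L (t.2 - z.2) := by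
  induction L generalizing t with
  | nil =>
    simp only [listEdges_nil, Set.mem_empty_iff_false, Set.iUnion_of_empty, Set.iUnion_empty,
      Set.union_empty, Set.mem_singleton_iff, totalHeight_nil, xAt, travel, add_zero, Prod.ext_iff]
    constructor
    · rintro ⟨h1, h2⟩
      exact ⟨by linarith, by linarith, h1⟩
    · rintro ⟨h1, h2, h3⟩
      exact ⟨h3, by linarith⟩
  | cons a L ih =>
    have ha := hd.edgeHeight_pos a
    have hs := hd.edgeSlope_mul_edgeHeight a
    have h2 : (d a).2 = -edgeHeight d a := by simp [edgeHeight]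
    have key : (z ∈ {t} ∪ ⋃ e ∈ listEdges d t (a :: L), segment ℝ e.1 (e.1 + d e.2)) ↔
        z ∈ segment ℝ t (t + d a) ∨
        z ∈ {t + d a} ∪ ⋃ e ∈ listEdges d (t + d a) L, segment ℝ e.1 (e.1 + d e.2) := by
      rw [listEdges_cons]
      simp only [Set.mem_union, Set.mem_singleton_iff, Set.mem_iUnion, exists_prop, or_and_right,
        exists_or, exists_eq_left]
      have e1 : z = t → z ∈ segment ℝ t (t + d a) := by rintro rfl; exact left_mem_segment _ _ _
      have e2 : z = t + d a → z ∈ segment ℝ t (t + d a) := by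
        rintro rfl; exact right_mem_segment _ _ _
      tauto
    rw [key, ih, mem_segment_edge_iff hd]
    simp only [Prod.snd_add, Prod.fst_add, h2, ← hs, totalHeight_cons, xAt, travel]
    have hL := totalHeight_nonneg hd.edgeHeight_pos L
    have es : t.2 + -edgeHeight d a - z.2 = t.2 - z.2 - edgeHeight d a := by ring
    rw [es]
    generalize t.2 - z.2 = s
    constructor
    · rintro (⟨h0, h1, h3⟩ | ⟨h0, h1, h3⟩)
      · refine ⟨h0, by linarith, ?_⟩
        rw [min_eq_left h1, max_eq_right h0, travel_of_nonpos hd.edgeHeight_pos _ (by linarith), h3]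
        ring
      · refine ⟨by linarith, by linarith, ?_⟩
        rw [min_eq_right (by linarith), max_eq_right ha.le, h3]
        ring
    · rintro ⟨h0, h1, h3⟩
      rcases le_total s (edgeHeight d a) with h | h
      · rw [min_eq_left h, max_eq_right h0,
          travel_of_nonpos hd.edgeHeight_pos _ (by linarith)] at h3
        exact Or.inl ⟨h0, h, by linarith⟩
      · rw [min_eq_right h, max_eq_right ha.le] at h3
        exact Or.inr ⟨by linarith, by linarith, by linarith⟩

theorem mem_pathTrace_iff (hd : IsEdgeSystem d) {k : ℕ} (t : ℝ × ℝ) (f : Fin k → Fin n)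
    (z : ℝ × ℝ) : z ∈ pathTrace d t f ↔ 0 ≤ t.2 - z.2 ∧ t.2 - z.2 ≤ depth d (List.ofFn f) ∧
      z.1 = t.1 + xAt d (List.ofFn f) (t.2 - z.2) := by
  rw [pathTrace, pathEdges_eq_listEdges, mem_listTrace_iff hd]

/-- The points between the paths `U` and `W` from the vertex `t`. -/
def between (d : Fin n → ℝ × ℝ) (t : ℝ × ℝ) (U W : List (Fin n)) : Set (ℝ × ℝ) :=
  {z | 0 ≤ t.2 - z.2 ∧ t.2 - z.2 ≤ depth d U ∧ t.1 + xAt d U (t.2 - z.2) ≤ z.1 ∧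
    z.1 ≤ t.1 + xAt d W (t.2 - z.2)}

theorem lt_of_mem_interior_between {t : ℝ × ℝ} {U W : List (Fin n)} {z : ℝ × ℝ}
    (hz : z ∈ interior (between d t U W)) :
    t.1 + xAt d U (t.2 - z.2) < z.1 ∧ z.1 < t.1 + xAt d W (t.2 - z.2) := by
  rw [mem_interior_iff_mem_nhds, Metric.mem_nhds_iff] at hz
  obtain ⟨ε, hε, hball⟩ := hz
  have h1 : (z.1 - ε / 2, z.2) ∈ between d t U W := by
    apply hball
    rw [Metric.mem_ball, Prod.dist_eq, dist_self, Real.dist_eq]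
    simp only [sub_sub_cancel_left, abs_neg, sup_lt_iff, hε, and_true]
    rw [abs_of_pos (by linarith)]
    linarith
  have h2 : (z.1 + ε / 2, z.2) ∈ between d t U W := by
    apply hball
    rw [Metric.mem_ball, Prod.dist_eq, dist_self, Real.dist_eq]
    simp only [add_sub_cancel_left, sup_lt_iff, hε, and_true]
    rw [abs_of_pos (by linarith)]
    linarith
  have h3 := h1.2.2.1
  have h4 := h2.2.2.2
  simp only at h3 h4
  exact ⟨by linarith, by linarith⟩

theorem mem_interior_between {t : ℝ × ℝ} {U W : List (Fin n)} {z : ℝ × ℝ}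
    (h0 : 0 < t.2 - z.2) (h1 : t.2 - z.2 < depth d U) (h2 : t.1 + xAt d U (t.2 - z.2) < z.1)
    (h3 : z.1 < t.1 + xAt d W (t.2 - z.2)) : z ∈ interior (between d t U W) := by
  rw [mem_interior]
  have hU : Continuous fun z : ℝ × ℝ => t.1 + xAt d U (t.2 - z.2) :=
    continuous_const.add ((continuous_travel U).comp (by fun_prop))
  have hW : Continuous fun z : ℝ × ℝ => t.1 + xAt d W (t.2 - z.2) :=
    continuous_const.add ((continuous_travel W).comp (by fun_prop))
  refine ⟨{z | 0 < t.2 - z.2} ∩ {z | t.2 - z.2 < depth d U} ∩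
    {z | t.1 + xAt d U (t.2 - z.2) < z.1} ∩ {z | z.1 < t.1 + xAt d W (t.2 - z.2)}, ?_, ?_,
    ⟨⟨h0, h1⟩, h2⟩, h3⟩
  · rintro y ⟨⟨⟨h0, h1⟩, h2⟩, h3⟩
    exact ⟨le_of_lt h0, le_of_lt h1, le_of_lt h2, le_of_lt h3⟩
  · refine ((IsOpen.inter ?_ ?_).inter ?_).inter ?_
    · exact isOpen_lt (by fun_prop) (by fun_prop)
    · exact isOpen_lt (by fun_prop) (by fun_prop)
    · exact isOpen_lt hU (by fun_prop)
    · exact isOpen_lt (by fun_prop) hW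

/-! ### Regions of paws and points next to their sides -/

namespace ElnitskyPolygon

/-- The labels of the left half from top to bottom. -/
def leftList (P : ElnitskyPolygon n) : List (Fin n) :=
  List.ofFn P.label

/-- The labels of the right half from top to bottom. -/
def rightList (P : ElnitskyPolygon n) : List (Fin n) :=
  List.ofFn fun i => P.label (P.perm i)

variable (P : ElnitskyPolygon n)

theorem leftList_sorted : P.leftList.Pairwise (· < ·) := by
  rw [leftList, List.pairwise_ofFn]
  exact fun i j h => P.label.strictMono h

theorem leftList_perm : P.leftList.Perm P.rightList :=
  (Equiv.Perm.ofFn_comp_perm P.perm P.label).symm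

theorem leftEdges_eq : P.leftEdges d = listEdges d P.top P.leftList :=
  pathEdges_eq_listEdges _ _

theorem rightEdges_eq : P.rightEdges d = listEdges d P.top P.rightList :=
  pathEdges_eq_listEdges _ _

theorem weakLE : WeakLE P.leftList P.rightList :=
  weakLE_of_pairwise_lt P.leftList_sorted P.leftList_perm

theorem region_eq (hd : IsEdgeSystem d) :
    P.region d = between d P.top P.leftList P.rightList := by
  ext z
  simp only [region, Set.mem_ofPred_eq, mem_pathTrace_iff hd, between]
  have hdep : depth d (List.ofFn fun i => P.label (P.perm i)) = depth d (List.ofFn P.label) :=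
    (totalHeight_perm P.leftList_perm).symm
  constructor
  · rintro ⟨l, ⟨hl0, hl1, hl2⟩, r, ⟨hr0, hr1, hr2⟩, e1, e2, h1, h2⟩
    rw [e1] at hl0 hl1 hl2
    rw [e2] at hr2
    exact ⟨hl0, hl1, hl2 ▸ h1, hr2 ▸ h2⟩
  · rintro ⟨h0, h1, h2, h3⟩
    exact ⟨(P.top.1 + xAt d P.leftList (P.top.2 - z.2), z.2), ⟨h0, h1, rfl⟩,
      (P.top.1 + xAt d P.rightList (P.top.2 - z.2), z.2), ⟨h0, hdep ▸ h1, rfl⟩, rfl, rfl, h2, h3⟩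

theorem rightList_X (w : Equiv.Perm (Fin n)) : (X w).rightList = List.ofFn w := rfl

theorem region_X (hd : IsEdgeSystem d) (w : Equiv.Perm (Fin n)) :
    (X w).region d = between d 0 (List.ofFn (1 : Equiv.Perm (Fin n))) (List.ofFn w) :=
  region_eq _ hd

/-- Slightly to the right of a vertex of the left half that is not on the right half is the interior. -/
theorem exists_mem_interior_right_of_left (hd : IsEdgeSystem d) {A B : List (Fin n)}
    (hL : P.leftList = A ++ B) (hA : A ≠ []) (hB : B ≠ [])
    (hR : ∀ R₁ R₂, P.rightList = R₁ ++ R₂ → ¬ R₁.Perm A) :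
    ∃ ε > 0, ∀ δ, 0 < δ → δ < ε →
      P.top + labelSum d A + (δ, 0) ∈ interior (P.region d) := by
  have hη := hd.edgeHeight_pos
  have hsort := P.leftList_sorted
  rw [hL, List.pairwise_append] at hsort
  -- If the right half were not strictly to the right at this depth, convexity of the left half
  -- would force it through the same vertex, with a rearrangement of `A` above.
  have hlt : xAt d (A ++ B) (depth d A) < xAt d P.rightList (depth d A) := by
    by_contra hle
    push Not at hle
    obtain ⟨R₁, R₂, h1, h2⟩ := exists_perm_prefix_of_travel_le hη
      (fun a ha b hb => hd.edgeSlope_strictMono (hsort.2.2 a ha b hb))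
      (hL ▸ P.leftList_perm) hle
    exact hR R₁ R₂ h1 h2
  rw [xAt_append_of_depth hd] at hlt
  refine ⟨xAt d P.rightList (depth d A) - (labelSum d A).1, by linarith, fun δ h0 h1 => ?_⟩
  have hs : P.top.2 - (P.top + labelSum d A + (δ, 0)).2 = depth d A := by
    rw [depth_eq]; simp
  rw [region_eq P hd]
  apply mem_interior_between <;> rw [hs]
  · exact totalHeight_pos hη hA
  · rw [hL, depth, depth, totalHeight_append]
    linarith [totalHeight_pos hη hB]
  · rw [hL, xAt_append_of_depth hd]
    simp only [Prod.fst_add]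
    linarith
  · simp only [Prod.fst_add]
    linarith

/-- Slightly to the left of a descent of the right half is the interior. -/
theorem exists_mem_interior_left_of_right (hd : IsEdgeSystem d) {A B : List (Fin n)} {x y : Fin n}
    (hR : P.rightList = A ++ B) (hx : x ∈ A) (hy : y ∈ B) (hxy : y < x) :
    ∃ ε > 0, ∀ δ, 0 < δ → δ < ε →
      P.top + labelSum d A - (δ, 0) ∈ interior (P.region d) := by
  have hη := hd.edgeHeight_pos
  have hlt : xAt d P.leftList (depth d A) < xAt d (A ++ B) (depth d A) :=
    travel_lt_of_descent hη (P.leftList_sorted.imp fun h => hd.edgeSlope_strictMono h)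
      (hR ▸ P.leftList_perm) hx hy (hd.edgeSlope_strictMono hxy)
  rw [xAt_append_of_depth hd] at hlt
  refine ⟨(labelSum d A).1 - xAt d P.leftList (depth d A), by linarith, fun δ h0 h1 => ?_⟩
  have hs : P.top.2 - (P.top + labelSum d A - (δ, 0)).2 = depth d A := by
    rw [depth_eq]; simp
  rw [region_eq P hd]
  apply mem_interior_between <;> rw [hs]
  · exact totalHeight_pos hη (List.ne_nil_of_mem hx)
  · rw [depth, depth, totalHeight_perm P.leftList_perm, hR, totalHeight_append]
    linarith [totalHeight_pos hη (List.ne_nil_of_mem hy)]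
  · simp only [Prod.fst_add, Prod.fst_sub]
    linarith
  · rw [hR, xAt_append_of_depth hd]
    simp only [Prod.fst_add, Prod.fst_sub]
    linarith

end ElnitskyPolygon

end Region

/-! ### Components of a paw and edge paths in a paw tiling -/

section Components

variable {n : ℕ}

/-- `M` and `N` are blocks of the lists `L` and `R`, in the same place (after `A` and `A'`, which are
rearrangements of each other), that are rearrangements of each other and have no proper nonempty
prefixes with this property. -/
structure IsComponent {α : Type*} (L R A M B A' N B' : List α) : Prop where
  left_eq : L = A ++ M ++ B
  right_eq : R = A' ++ N ++ B'
  perm_above : A.Perm A'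
  perm : M.Perm N
  unpinched : ∀ X Y X' Y', M = X ++ Y → N = X' ++ Y' → X.Perm X' → X = [] ∨ Y = []

namespace IsComponent

variable {α : Type*} {L R A M B A' N B' A₂ M₂ B₂ A₂' N₂ B₂' : List α}

/-- Comparison of lengths places the end of `R₁` inside the block `N`, so it would be a pinch of the
component. -/
theorem eq_nil_or_of_perm_append (h : IsComponent L R A M B A' N B') {X Y R₁ R₂ : List α}
    (hM : M = X ++ Y) (hR : R = R₁ ++ R₂) (hp : (A ++ X).Perm R₁) : X = [] ∨ Y = [] := by
  have hlen := hp.length_eq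
  have hlA := h.perm_above.length_eq
  have hlM := h.perm.length_eq
  rw [List.length_append] at hlen
  rw [hM, List.length_append] at hlM
  have e : A' ++ (N ++ B') = R₁ ++ R₂ := by rw [← List.append_assoc, ← h.right_eq, hR]
  obtain ⟨X', rfl, e2⟩ : ∃ X', R₁ = A' ++ X' ∧ N ++ B' = X' ++ R₂ := by
    rcases List.append_eq_append_iff.1 e with h' | ⟨Z, rfl, h2⟩
    · exact h'
    · rw [List.length_append] at hlA
      have : Z = [] := List.length_eq_zero_iff.1 (by omega)
      subst this
      exact ⟨[], by simp, by simpa using h2.symm⟩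
  rw [List.length_append] at hlen
  obtain ⟨Y', rfl, -⟩ : ∃ Y', N = X' ++ Y' ∧ R₂ = Y' ++ B' := by
    rcases List.append_eq_append_iff.1 e2 with ⟨Z, rfl, h2⟩ | h'
    · rw [List.length_append] at hlen
      have : Z = [] := List.length_eq_zero_iff.1 (by omega)
      subst this
      exact ⟨[], by simp, by simpa using h2.symm⟩
    · exact h'
  exact h.unpinched X Y X' Y' hM rfl
    ((List.perm_append_left_iff A').1 ((h.perm_above.symm.append_right X).trans hp))

/-- The start of the second component is a vertex common to both halves; lying inside the first
component, it must be the start of that one. -/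
theorem above_eq_of_append (h : IsComponent L R A M B A' N B')
    (h₂ : IsComponent L R A₂ M₂ B₂ A₂' N₂ B₂') {X Y X₂ Y₂ Z : List α} (hM : M = X ++ Y)
    (hY : Y ≠ []) (hX : A ++ X = A₂ ++ X₂) (hZ : A₂ = A ++ Z) (_ : M₂ = X₂ ++ Y₂) :
    A₂ = A := by
  subst hZ
  rw [List.append_assoc, List.append_cancel_left_eq] at hX
  subst hX
  rcases h.eq_nil_or_of_perm_append (X := Z) (Y := X₂ ++ Y) (by simpa using hM)
    (by rw [h₂.right_eq, List.append_assoc]) h₂.perm_above with h' | h'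
  · simp [h']
  · exact absurd (List.append_eq_nil_iff.1 h').2 hY

theorem above_eq (h : IsComponent L R A M B A' N B')
    (h₂ : IsComponent L R A₂ M₂ B₂ A₂' N₂ B₂') {X Y X₂ Y₂ : List α} (hM : M = X ++ Y)
    (hM₂ : M₂ = X₂ ++ Y₂) (hY : Y ≠ []) (hY₂ : Y₂ ≠ []) (hX : A ++ X = A₂ ++ X₂) : A = A₂ := by
  rcases List.append_eq_append_iff.1 hX with ⟨Z, hZ, -⟩ | ⟨Z, hZ, -⟩
  · exact (h.above_eq_of_append h₂ hM hY hX hZ hM₂).symm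
  · exact h₂.above_eq_of_append h hM₂ hY₂ hX.symm hZ hM

/-- The end of the shorter block is common to both halves and would pinch the longer one. -/
theorem block_eq_of_append (h : IsComponent L R A M B A' N B')
    (h₂ : IsComponent L R A M₂ B₂ A₂' N₂ B₂') (hM : M ≠ []) {Z : List α} (hZ : M₂ = M ++ Z) :
    M₂ = M := by
  rcases h₂.eq_nil_or_of_perm_append hZ h.right_eq (h.perm_above.append h.perm) with h' | h'
  · exact absurd h' hM
  · rw [hZ, h', List.append_nil]

theorem block_eq (h : IsComponent L R A M B A' N B')
    (h₂ : IsComponent L R A M₂ B₂ A₂' N₂ B₂') (hM : M ≠ []) (hM₂ : M₂ ≠ []) :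
    M = M₂ ∧ N = N₂ := by
  have hMM : M = M₂ := by
    have e : M ++ B = M₂ ++ B₂ := by
      have := h.left_eq.symm.trans h₂.left_eq
      simpa using this
    rcases List.append_eq_append_iff.1 e with ⟨Z, hZ, -⟩ | ⟨Z, hZ, -⟩
    · exact (h.block_eq_of_append h₂ hM hZ).symm
    · exact h₂.block_eq_of_append h hM₂ hZ
  refine ⟨hMM, ?_⟩
  have e := h.right_eq.symm.trans h₂.right_eq
  rw [List.append_assoc, List.append_assoc] at e
  have e' := (List.append_inj e (h.perm_above.symm.trans h₂.perm_above).length_eq).2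
  exact (List.append_inj e' ((h.perm.symm.trans (hMM ▸ h₂.perm)).length_eq)).1

end IsComponent

variable {d : Fin n → ℝ × ℝ}

/-- An edge of the left path that is not on the right path lies in a component. -/
theorem exists_component {t : ℝ × ℝ} {L R : List (Fin n)} (hp : L.Perm R)
    {e : (ℝ × ℝ) × Fin n} (he : e ∈ listEdges d t L) (he' : e ∉ listEdges d t R) :
    ∃ A M B A' N B', IsComponent L R A M B A' N B' ∧ e ∈ listEdges d (t + labelSum d A) M ∧
      e ∉ listEdges d (t + labelSum d A) N := by
  induction hm : L.length using Nat.strong_induction_on generalizing t L R with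
  | _ m ih =>
    by_cases h : ∀ X Y X' Y', L = X ++ Y → R = X' ++ Y' → X.Perm X' → X = [] ∨ Y = []
    · exact ⟨[], L, [], [], R, [], ⟨by simp, by simp, List.Perm.refl _, hp, h⟩, by simpa using he,
        by simpa using he'⟩
    -- At a pinch the halves pass through the same vertex, so the paw splits there; `e` lies on the
    -- left half of one part and off the right half of both.
    · push Not at h
      obtain ⟨X, Y, X', Y', rfl, rfl, hX, hXne, hYne⟩ := h
      have hY : Y.Perm Y' :=
        (List.perm_append_left_iff X).1 (hp.trans (hX.symm.append_right Y'))
      have hsum := labelSum_perm (d := d) hX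
      have hlX := List.length_pos_iff.2 hXne
      have hlY := List.length_pos_iff.2 hYne
      rw [List.length_append] at hm
      rw [listEdges_append] at he he'
      rw [Set.mem_union, not_or, ← hsum] at he'
      rcases he with he | he
      · obtain ⟨A, M, B, A', N, B', hc, h1, h2⟩ := ih X.length (by omega) hX he he'.1 rfl
        refine ⟨A, M, B ++ Y, A', N, B' ++ Y', ⟨?_, ?_, hc.perm_above, hc.perm, hc.unpinched⟩,
          h1, h2⟩
        · simp [hc.left_eq]
        · simp [hc.right_eq]
      · obtain ⟨A, M, B, A', N, B', hc, h1, h2⟩ := ih Y.length (by omega) hY he he'.2 rfl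
        refine ⟨X ++ A, M, B, X' ++ A', N, B',
          ⟨?_, ?_, hX.append hc.perm_above, hc.perm, hc.unpinched⟩, ?_, ?_⟩
        · simp [hc.left_eq]
        · simp [hc.right_eq]
        · rwa [labelSum_append, ← add_assoc]
        · rwa [labelSum_append, ← add_assoc]

/-! ### From a paw tiling to a tile complex -/

open ElnitskyPolygon

/-- The nondegenerate components of the tiles in `T`. -/
def tileComponents (d : Fin n → ℝ × ℝ) (T : Set (ElnitskyPolygon n)) : Set (ListTile n) :=
  {C | C.left ≠ C.right ∧ ∃ P ∈ T, ∃ A B A' B',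
    IsComponent P.leftList P.rightList A C.left B A' C.right B' ∧ C.top = P.top + labelSum d A}

theorem exists_tileComponent {T : Set (ElnitskyPolygon n)} {P : ElnitskyPolygon n} (hP : P ∈ T)
    {e : (ℝ × ℝ) × Fin n} (he : e ∈ P.leftEdges d) (he' : e ∉ P.rightEdges d) :
    ∃ C ∈ tileComponents d T, e ∈ listEdges d C.top C.left := by
  rw [leftEdges_eq] at he
  rw [rightEdges_eq] at he'
  obtain ⟨A, M, B, A', N, B', hc, h1, h2⟩ := exists_component P.leftList_perm he he'
  refine ⟨⟨P.top + labelSum d A, M, N⟩, ⟨?_, P, hP, A, B, A', B', hc, rfl⟩, h1⟩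
  rintro h : M = N
  exact h2 (h ▸ h1)

/-- Slightly to the right of an inner vertex of the left half of a component is the interior of its
paw. -/
theorem IsComponent.exists_mem_interior (hd : IsEdgeSystem d) {P : ElnitskyPolygon n}
    {A M B A' N B' X Y : List (Fin n)} (h : IsComponent P.leftList P.rightList A M B A' N B')
    (hM : M = X ++ Y) (hX : X ≠ []) (hY : Y ≠ []) :
    ∃ ε > 0, ∀ δ, 0 < δ → δ < ε →
      P.top + labelSum d A + labelSum d X + (δ, 0) ∈ interior (P.region d) := by
  have := P.exists_mem_interior_right_of_left hd (A := A ++ X) (B := Y ++ B)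
    (by rw [h.left_eq, hM]; simp) (by simp [hX]) (by simp [hY]) ?_
  · rwa [labelSum_append, ← add_assoc] at this
  · intro R₁ R₂ hR hp
    rcases h.eq_nil_or_of_perm_append hM hR hp.symm with h' | h'
    · exact hX h'
    · exact hY h'

theorem IsPawTiling.isTileComplex (hd : IsEdgeSystem d) {w : Equiv.Perm (Fin n)}
    {T : Set (ElnitskyPolygon n)} (hT : IsPawTiling d w T) :
    IsTileComplex d (List.ofFn w) (tileComponents d T) where
  sorted := by
    rintro C ⟨-, P, hP, A, B, A', B', hc, -⟩
    have := P.leftList_sorted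
    rw [hc.left_eq, List.pairwise_append, List.pairwise_append] at this
    exact this.1.2.1
  perm := by
    rintro C ⟨-, P, hP, A, B, A', B', hc, -⟩
    exact hc.perm
  head_lt := by
    rintro C ⟨hne, P, hP, A, B, A', B', hc, -⟩ a L b R hL hR
    have hs := P.leftList_sorted
    rw [hc.left_eq, List.pairwise_append, List.pairwise_append, hL, List.pairwise_cons] at hs
    have hb : b ∈ a :: L := hL ▸ hc.perm.symm.subset (by simp [hR])
    rcases List.mem_cons.1 hb with rfl | hb
    -- A common first edge would be a pinch, so the component would be that single edge with equal
    -- halves.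
    · exfalso
      rcases hc.unpinched [b] L [b] R hL hR (List.Perm.refl _) with h | h
      · simp at h
      · have hp := hc.perm
        rw [hL, hR, List.perm_cons, h, List.nil_perm] at hp
        exact hne (by rw [hL, hR, h, hp])
    · exact hs.1.2.1.1 b hb
  last_lt := by
    rintro C ⟨hne, P, hP, A, B, A', B', hc, -⟩ a L b R hL hR
    have hs := P.leftList_sorted
    rw [hc.left_eq, List.pairwise_append, List.pairwise_append, hL, List.pairwise_append] at hs
    have hb : b ∈ L ++ [a] := hL ▸ hc.perm.symm.subset (by simp [hR])
    rcases List.mem_append.1 hb with hb | hb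
    · exact hs.1.2.1.2.2 b hb a (by simp)
    · obtain rfl := List.mem_singleton.1 hb
      exfalso
      have hp := hc.perm
      rw [hL, hR, List.perm_append_right_iff] at hp
      rcases hc.unpinched L [b] R [b] hL hR hp with h | h
      · rw [h, List.nil_perm] at hp
        exact hne (by rw [hL, hR, h, hp])
      · simp at h
  unique := by
    rintro C ⟨-, P, hP, A, B, A', B', hc, ht⟩ C₂ ⟨-, P₂, hP₂, A₂, B₂, A₂', B₂', hc₂, ht₂⟩
      X Y X₂ Y₂ hX hY hX₂ hY₂ hL hL₂ hv
    obtain ⟨ε, hε, hint⟩ := hc.exists_mem_interior hd hL hX hY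
    obtain ⟨ε₂, hε₂, hint₂⟩ := hc₂.exists_mem_interior hd hL₂ hX₂ hY₂
    rw [← ht] at hint
    rw [← ht₂, ← hv] at hint₂
    obtain ⟨δ, hδ0, hδ⟩ := exists_between (lt_min hε hε₂)
    -- Points just to the right of the common vertex are interior to both paws.
    have hPP : P = P₂ := by
      by_contra hne
      exact Set.disjoint_left.1 (hT.no_overlap P hP P₂ hP₂ hne)
        (hint δ hδ0 (hδ.trans_le (min_le_left _ _)))
        (interior_subset (hint₂ δ hδ0 (hδ.trans_le (min_le_right _ _))))
    subst hPP
    have hAX : A ++ X = A₂ ++ X₂ := by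
      refine (append_inj_of_labelSum hd.down (A := A ++ X) (B := Y ++ B) (A' := A₂ ++ X₂)
        (B' := Y₂ ++ B₂) ?_ ?_).1
      · have := hc.left_eq.symm.trans hc₂.left_eq
        rw [hL, hL₂] at this
        simpa using this
      · rw [ht, ht₂, add_assoc, add_assoc] at hv
        simpa using hv
    obtain rfl := hc.above_eq hc₂ hL hL₂ hY hY₂ hAX
    obtain ⟨h1, h2⟩ := hc.block_eq hc₂ (by simp [hL, hX]) (by simp [hL₂, hX₂])
    cases C
    cases C₂
    simp only at h1 h2 ht ht₂
    subst h1 h2 ht ht₂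
    rfl
  not_border := by
    rintro C ⟨-, P, hP, A, B, A', B', hc, ht⟩ X Y X' Y' hX hY hL hW hv
    obtain ⟨ε, hε, hint⟩ := hc.exists_mem_interior hd hL hX hY
    obtain ⟨δ, hδ0, hδ⟩ := exists_between hε
    -- A point just to the right of a vertex of the right border is outside `X(w)`.
    have hmem := hT.inside P hP (interior_subset (hint δ hδ0 hδ))
    rw [← ht, hv, region_X hd, hW] at hmem
    have h3 := hmem.2.2.2
    have hs : (0 : ℝ × ℝ).2 - (labelSum d X' + (δ, 0)).2 = depth d X' := by
      rw [depth_eq]; simp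
    rw [hs, xAt_append_of_depth hd] at h3
    simp only [Prod.fst_add, Prod.fst_zero, zero_add] at h3
    linarith
  right_good := by
    rintro C ⟨-, P, hP, A, B, A', B', hc, ht⟩ e he
    have heP : e ∈ P.rightEdges d := by
      rw [rightEdges_eq, hc.right_eq, listEdges_append, listEdges_append,
        ← labelSum_perm hc.perm_above, ← ht]
      exact Or.inl (Or.inr he)
    rcases hT.right_edge P hP e heP with h | ⟨Q, hQ, h1, h2⟩
    · left
      rwa [rightEdges_eq, rightList_X] at h
    -- That the edge is off the right half of `Q` is what puts it into a nondegenerate component.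
    · exact Or.inr (exists_tileComponent hQ h1 h2)
  finite := by
    have hfin : ((X w).rightEdges d ∪ ⋃ P ∈ T, P.leftEdges d).Finite :=
      (Set.finite_range _).union (hT.finite.biUnion fun P _ => Set.finite_range _)
    refine hfin.subset ?_
    rintro e (he | ⟨C, ⟨-, P, hP, A, B, A', B', hc, ht⟩, he⟩)
    · left
      rwa [rightEdges_eq, rightList_X]
    · refine Or.inr (Set.mem_biUnion hP ?_)
      rw [leftEdges_eq, hc.left_eq, listEdges_append, listEdges_append, ← ht]
      exact Or.inl (Or.inr he)

/-- The right half of a tile of a paw tiling of `X(w)` extends to an edge path below `w` in the weak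
order. -/
theorem IsPawTiling.exists_weakLE (hd : IsEdgeSystem d) {w : Equiv.Perm (Fin n)}
    {T : Set (ElnitskyPolygon n)} (hT : IsPawTiling d w T) {P : ElnitskyPolygon n} (hP : P ∈ T)
    (hne : P.rightList ≠ []) :
    ∃ A B, labelSum d A = P.top ∧ WeakLE (A ++ P.rightList ++ B) (List.ofFn w) := by
  refine (hT.isTileComplex hd).exists_weakLE hd.down hne fun e he => ?_
  rw [← rightEdges_eq] at he
  rcases hT.right_edge P hP e he with h | ⟨Q, hQ, h1, h2⟩
  · left
    rwa [rightEdges_eq, rightList_X] at h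
  · exact Or.inr (exists_tileComponent hQ h1 h2)

end Components

/-! ### Tilings from chains in the weak order -/

section Construction

variable {n : ℕ} {d : Fin n → ℝ × ℝ}

open ElnitskyPolygon

/-- `T` is a paw tiling of the part of the plane between the paths `U` and `W` from the origin. -/
structure IsTilingBetween (d : Fin n → ℝ × ℝ) (U W : List (Fin n))
    (T : Set (ElnitskyPolygon n)) : Prop where
  perm : U.Perm W
  le : ∀ s, xAt d U s ≤ xAt d W s
  finite : T.Finite
  inside : ∀ P ∈ T, P.region d ⊆ between d 0 U W
  cover : ∀ z ∈ between d 0 U W,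
    xAt d U ((0 : ℝ × ℝ).2 - z.2) < xAt d W ((0 : ℝ × ℝ).2 - z.2) → z ∈ ⋃ P ∈ T, P.region d
  no_overlap : ∀ P ∈ T, ∀ Q ∈ T, P ≠ Q → Disjoint (interior (P.region d)) (Q.region d)
  right_edge : ∀ P ∈ T, ∀ e ∈ P.rightEdges d,
    e ∈ listEdges d 0 W ∨ ∃ Q ∈ T, e ∈ Q.leftEdges d ∧ e ∉ Q.rightEdges d
  left_edge : ∀ P ∈ T, ∀ e ∈ P.leftEdges d,
    e ∈ listEdges d 0 U ∨ ∃ Q ∈ T, e ∈ Q.rightEdges d ∧ e ∉ Q.leftEdges d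
  -- The two border clauses make gluing possible: an edge on the common path is handed on to a tile
  -- of the other piece or to its far border.
  left_border : ∀ e ∈ listEdges d 0 U,
    e ∈ listEdges d 0 W ∨ ∃ Q ∈ T, e ∈ Q.leftEdges d ∧ e ∉ Q.rightEdges d
  right_border : ∀ e ∈ listEdges d 0 W,
    e ∈ listEdges d 0 U ∨ ∃ Q ∈ T, e ∈ Q.rightEdges d ∧ e ∉ Q.leftEdges d

namespace IsTilingBetween

variable {U V W : List (Fin n)} {T T₁ T₂ : Set (ElnitskyPolygon n)}

theorem refl (U : List (Fin n)) : IsTilingBetween d U U ∅ where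
  perm := List.Perm.refl _
  le _ := le_rfl
  finite := Set.finite_empty
  inside := by simp
  cover z _ h := absurd h (lt_irrefl _)
  no_overlap := by simp
  right_edge := by simp
  left_edge := by simp
  left_border e he := Or.inl he
  right_border e he := Or.inl he

/-- The path `V` separates the two pieces: interiors of tiles lie strictly on their own side of it,
and a point is covered from the side it is on. -/
theorem trans (h₁ : IsTilingBetween d U V T₁) (h₂ : IsTilingBetween d V W T₂) :
    IsTilingBetween d U W (T₁ ∪ T₂) where
  perm := h₁.perm.trans h₂.perm
  le s := (h₁.le s).trans (h₂.le s)
  finite := h₁.finite.union h₂.finite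
  inside := by
    rintro P (hP | hP) z hz
    · obtain ⟨a, b, c, e⟩ := h₁.inside P hP hz
      exact ⟨a, b, c, e.trans (by linarith [h₂.le ((0 : ℝ × ℝ).2 - z.2)])⟩
    · obtain ⟨a, b, c, e⟩ := h₂.inside P hP hz
      refine ⟨a, ?_, le_trans (by linarith [h₁.le ((0 : ℝ × ℝ).2 - z.2)]) c, e⟩
      rwa [depth, totalHeight_perm h₁.perm]
  cover := by
    intro z hz hlt
    rw [Set.biUnion_union]
    obtain ⟨h0, h1, h2, h3⟩ := hz
    have h1' : (0 : ℝ × ℝ).2 - z.2 ≤ depth d V := by rwa [depth, ← totalHeight_perm h₁.perm]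
    have c₁ := fun h => h₁.cover z ⟨h0, h1, h2, h⟩
    have c₂ := fun h => h₂.cover z ⟨h0, h1', h, h3⟩
    have l₁ := h₁.le ((0 : ℝ × ℝ).2 - z.2)
    have l₂ := h₂.le ((0 : ℝ × ℝ).2 - z.2)
    rcases le_total z.1 ((0 : ℝ × ℝ).1 + xAt d V ((0 : ℝ × ℝ).2 - z.2)) with h | h
    -- Where `U` and `V` coincide, a point to the left of `V` lies on `V`, and the second piece must
    -- cover it.
    · rcases l₁.lt_or_eq with h' | h'
      · exact Or.inl (c₁ h h')
      · exact Or.inr (c₂ (h' ▸ h2) (h' ▸ hlt))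
    · rcases l₂.lt_or_eq with h' | h'
      · exact Or.inr (c₂ h h')
      · exact Or.inl (c₁ (h'.symm ▸ h3) (h'.symm ▸ hlt))
  no_overlap := by
    have key₁ : ∀ P ∈ T₁, ∀ Q ∈ T₂, Disjoint (interior (P.region d)) (Q.region d) := by
      intro P hP Q hQ
      rw [Set.disjoint_left]
      intro z hz hz'
      have a := (lt_of_mem_interior_between (interior_mono (h₁.inside P hP) hz)).2
      have b := (h₂.inside Q hQ hz').2.2.1
      linarith
    have key₂ : ∀ P ∈ T₂, ∀ Q ∈ T₁, Disjoint (interior (P.region d)) (Q.region d) := by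
      intro P hP Q hQ
      rw [Set.disjoint_left]
      intro z hz hz'
      have a := (lt_of_mem_interior_between (interior_mono (h₂.inside P hP) hz)).1
      have b := (h₁.inside Q hQ hz').2.2.2
      linarith
    rintro P (hP | hP) Q (hQ | hQ) hne
    · exact h₁.no_overlap P hP Q hQ hne
    · exact key₁ P hP Q hQ
    · exact key₂ P hP Q hQ
    · exact h₂.no_overlap P hP Q hQ hne
  right_edge := by
    rintro P (hP | hP) e he
    · rcases h₁.right_edge P hP e he with h | ⟨Q, hQ, h⟩
      · rcases h₂.left_border e h with h | ⟨Q, hQ, h⟩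
        · exact Or.inl h
        · exact Or.inr ⟨Q, Or.inr hQ, h⟩
      · exact Or.inr ⟨Q, Or.inl hQ, h⟩
    · rcases h₂.right_edge P hP e he with h | ⟨Q, hQ, h⟩
      · exact Or.inl h
      · exact Or.inr ⟨Q, Or.inr hQ, h⟩
  left_edge := by
    rintro P (hP | hP) e he
    · rcases h₁.left_edge P hP e he with h | ⟨Q, hQ, h⟩
      · exact Or.inl h
      · exact Or.inr ⟨Q, Or.inl hQ, h⟩
    · rcases h₂.left_edge P hP e he with h | ⟨Q, hQ, h⟩
      · rcases h₁.right_border e h with h | ⟨Q, hQ, h⟩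
        · exact Or.inl h
        · exact Or.inr ⟨Q, Or.inl hQ, h⟩
      · exact Or.inr ⟨Q, Or.inr hQ, h⟩
  left_border := by
    intro e he
    rcases h₁.left_border e he with h | ⟨Q, hQ, h⟩
    · rcases h₂.left_border e h with h | ⟨Q, hQ, h⟩
      · exact Or.inl h
      · exact Or.inr ⟨Q, Or.inr hQ, h⟩
    · exact Or.inr ⟨Q, Or.inl hQ, h⟩
  right_border := by
    intro e he
    rcases h₂.right_border e he with h | ⟨Q, hQ, h⟩
    · rcases h₁.right_border e h with h | ⟨Q, hQ, h⟩
      · exact Or.inl h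
      · exact Or.inr ⟨Q, Or.inl hQ, h⟩
    · exact Or.inr ⟨Q, Or.inr hQ, h⟩

/-- A single paw tiles the part between the two paths that pass along its halves. -/
theorem single (hd : IsEdgeSystem d) {P : ElnitskyPolygon n} {A B : List (Fin n)}
    (hA : labelSum d A = P.top) :
    IsTilingBetween d (A ++ P.leftList ++ B) (A ++ P.rightList ++ B) {P} := by
  have hη := hd.edgeHeight_pos
  have hx : ∀ (L : List (Fin n)) (s : ℝ), depth d A ≤ s → s ≤ depth d A + depth d L →
      xAt d (A ++ L ++ B) s = P.top.1 + xAt d L (s - depth d A) := by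
    intro L s h0 h1
    rw [xAt, travel_append, travel_append, ← xAt, xAt_of_depth_le hd h0, hA,
      travel_of_nonpos hη B (by rw [totalHeight_append]; linarith), add_zero]
  have hdep : depth d P.rightList = depth d P.leftList := (totalHeight_perm P.leftList_perm).symm
  have hsum := labelSum_perm (d := d) P.leftList_perm
  have htop : P.top.2 = -depth d A := by rw [depth_eq, hA, neg_neg]
  have hw := WeakLE.context P.weakLE A B
  have hleft : P.leftEdges d ⊆ listEdges d 0 (A ++ P.leftList ++ B) := by
    rw [leftEdges_eq, listEdges_append, listEdges_append, zero_add, hA]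
    exact fun e he => Or.inl (Or.inr he)
  have hright : P.rightEdges d ⊆ listEdges d 0 (A ++ P.rightList ++ B) := by
    rw [rightEdges_eq, listEdges_append, listEdges_append, zero_add, hA]
    exact fun e he => Or.inl (Or.inr he)
  refine ⟨WeakLE.perm hw, fun s => WeakLE.xAt_le hd hw s, Set.finite_singleton P, ?_, ?_, ?_, ?_, ?_,
    ?_, ?_⟩
  · rintro Q rfl z hz
    rw [region_eq _ hd] at hz
    obtain ⟨h0, h1, h2, h3⟩ := hz
    rw [htop] at h0 h1 h2 h3
    have e : -depth d A - z.2 = (0 : ℝ × ℝ).2 - z.2 - depth d A := by simp; ring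
    rw [e] at h0 h1 h2 h3
    have hBn := totalHeight_nonneg hη B
    refine ⟨?_, ?_, ?_, ?_⟩
    · linarith [totalHeight_nonneg hη A]
    · simp only [depth, totalHeight_append] at *
      linarith
    · rw [hx _ _ (by linarith) (by linarith)]
      simpa using h2
    · rw [hx _ _ (by linarith) (by linarith)]
      simpa using h3
  · intro z hz hlt
    obtain ⟨h0, h1, h2, h3⟩ := hz
    simp only [Set.mem_singleton_iff, Set.iUnion_iUnion_eq_left]
    -- Above the paw, and likewise below it in `hL'`, the two paths coincide, so nothing has to be
    -- covered there.
    have hA' : depth d A ≤ (0 : ℝ × ℝ).2 - z.2 := by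
      by_contra h
      push Not at h
      rw [xAt, xAt, travel_append, travel_append, travel_append, travel_append,
        travel_of_nonpos hη P.leftList (by linarith), travel_of_nonpos hη P.rightList (by linarith),
        totalHeight_append, totalHeight_append,
        ← totalHeight_perm P.leftList_perm] at hlt
      exact lt_irrefl _ hlt
    have hL' : (0 : ℝ × ℝ).2 - z.2 ≤ depth d A + depth d P.leftList := by
      by_contra h
      push Not at h
      rw [xAt, xAt, travel_append, travel_append, travel_append, travel_append, ← xAt, ← xAt, ← xAt,
        xAt_of_depth_le hd (L := P.leftList) (by linarith),
        ← xAt, xAt_of_depth_le hd (L := P.rightList) (by rw [hdep]; linarith),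
        totalHeight_append, totalHeight_append,
        ← totalHeight_perm P.leftList_perm, hsum] at hlt
      exact lt_irrefl _ hlt
    rw [region_eq _ hd]
    rw [hx _ _ hA' hL'] at h2
    rw [hx _ _ hA' (by rwa [hdep])] at h3
    have e : P.top.2 - z.2 = (0 : ℝ × ℝ).2 - z.2 - depth d A := by rw [htop]; simp; ring
    refine ⟨?_, ?_, ?_, ?_⟩ <;> rw [e]
    · linarith
    · linarith
    · simpa using h2
    · simpa using h3
  · rintro Q rfl Q' rfl h
    exact absurd rfl h
  · rintro Q rfl e he
    exact Or.inl (hright he)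
  · rintro Q rfl e he
    exact Or.inl (hleft he)
  · intro e he
    by_cases hP : e ∈ P.rightEdges d
    · exact Or.inl (hright hP)
    · rw [listEdges_append, listEdges_append, zero_add, hA] at he
      rcases he with (he | he) | he
      · left
        rw [listEdges_append, listEdges_append]
        exact Or.inl (Or.inl he)
      · exact Or.inr ⟨P, rfl, by rwa [leftEdges_eq], hP⟩
      · left
        rw [listEdges_append _ (A ++ P.rightList), labelSum_append, ← hsum, ← labelSum_append]
        exact Or.inr he
  · intro e he
    by_cases hP : e ∈ P.leftEdges d
    · exact Or.inl (hleft hP)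
    · rw [listEdges_append, listEdges_append, zero_add, hA] at he
      rcases he with (he | he) | he
      · left
        rw [listEdges_append, listEdges_append]
        exact Or.inl (Or.inl he)
      · exact Or.inr ⟨P, rfl, by rwa [rightEdges_eq], hP⟩
      · left
        rw [listEdges_append _ (A ++ P.leftList), labelSum_append, hsum, ← labelSum_append]
        exact Or.inr he

theorem isPawTiling (hd : IsEdgeSystem d) {w : Equiv.Perm (Fin n)}
    (h : IsTilingBetween d (List.ofFn (1 : Equiv.Perm (Fin n))) (List.ofFn w) T) :
    IsPawTiling d w T where
  finite := h.finite
  inside P hP := by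
    rw [region_X hd]
    exact h.inside P hP
  cover := by
    intro z hz
    rw [region_X hd] at hz
    have := lt_of_mem_interior_between hz
    exact h.cover z (interior_subset hz) (by linarith)
  no_overlap := h.no_overlap
  right_edge := by
    rw [rightEdges_eq]
    exact h.right_edge
  left_edge := by
    rw [leftEdges_eq]
    exact h.left_edge

end IsTilingBetween

/-- The rhombus with top vertex `t` and labels `a < b`. -/
def rhombus (t : ℝ × ℝ) {a b : Fin n} (hab : a < b) : ElnitskyPolygon n where
  size := 2
  top := t
  label := OrderEmbedding.ofStrictMono ![a, b] (by
    rw [Fin.strictMono_iff_lt_succ]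
    intro i
    fin_cases i
    exact hab)
  perm := Equiv.swap 0 1

theorem rhombus_isRhombus (t : ℝ × ℝ) {a b : Fin n} (hab : a < b) : (rhombus t hab).IsRhombus :=
  ⟨t, _, rfl⟩

theorem leftList_of_size_two (t : ℝ × ℝ) (l : Fin 2 ↪o Fin n) (p : Equiv.Perm (Fin 2)) :
    leftList ⟨2, t, l, p⟩ = [l 0, l 1] := by
  change List.ofFn l = _
  simp [List.ofFn_succ]

theorem rightList_of_swap (t : ℝ × ℝ) (l : Fin 2 ↪o Fin n) :
    rightList ⟨2, t, l, Equiv.swap 0 1⟩ = [l 1, l 0] := by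
  change List.ofFn (fun i => l (Equiv.swap 0 1 i)) = _
  simp [List.ofFn_succ]

theorem rhombus_leftList (t : ℝ × ℝ) {a b : Fin n} (hab : a < b) :
    (rhombus t hab).leftList = [a, b] :=
  leftList_of_size_two _ _ _

theorem rhombus_rightList (t : ℝ × ℝ) {a b : Fin n} (hab : a < b) :
    (rhombus t hab).rightList = [b, a] :=
  rightList_of_swap _ _

theorem IsTilingBetween.rhombus (hd : IsEdgeSystem d) (A B : List (Fin n)) {a b : Fin n}
    (hab : a < b) :
    IsTilingBetween d (A ++ a :: b :: B) (A ++ b :: a :: B) {rhombus (labelSum d A) hab} := by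
  have := IsTilingBetween.single hd (P := _root_.rhombus (labelSum d A) hab) (A := A) (B := B) rfl
  rw [rhombus_leftList, rhombus_rightList] at this
  simpa using this

theorem WeakLE.exists_rhombus_tiling (hd : IsEdgeSystem d) {U W : List (Fin n)} (h : WeakLE U W) :
    ∃ T, IsTilingBetween d U W T ∧ ∀ P ∈ T, P.IsRhombus := by
  induction h with
  | refl => exact ⟨∅, IsTilingBetween.refl U, by simp⟩
  | tail _ h ih =>
    obtain ⟨T, hT, hr⟩ := ih
    obtain ⟨A, B, a, b, hab, rfl, rfl⟩ := h
    refine ⟨T ∪ {rhombus (labelSum d A) hab}, hT.trans (IsTilingBetween.rhombus hd A B hab), ?_⟩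
    rintro P (hP | rfl)
    · exact hr P hP
    · exact rhombus_isRhombus _ _

/-- A paw whose right half lies on a path below `w` is part of a paw tiling of `X(w)` whose other tiles
are rhombi and contain the tiles of a given tiling between that path and `w`. -/
theorem exists_pawTiling_of_path (hd : IsEdgeSystem d) {w : Equiv.Perm (Fin n)}
    {P : ElnitskyPolygon n} {A B : List (Fin n)} (hA : labelSum d A = P.top)
    {T₂ : Set (ElnitskyPolygon n)}
    (hT₂ : IsTilingBetween d (A ++ P.rightList ++ B) (List.ofFn w) T₂)
    (hr₂ : ∀ Q ∈ T₂, Q.IsRhombus) :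
    ∃ T, IsPawTiling d w T ∧ P ∈ T ∧ T₂ ⊆ T ∧ ∀ Q ∈ T, Q ≠ P → Q.IsRhombus := by
  have hs := IsTilingBetween.single hd (B := B) hA
  obtain ⟨T₁, hT₁, hr₁⟩ := WeakLE.exists_rhombus_tiling hd
    (weakLE_ofFn_one w (hs.perm.trans hT₂.perm))
  refine ⟨T₁ ∪ {P} ∪ T₂, ((hT₁.trans hs).trans hT₂).isPawTiling hd, by simp,
    Set.subset_union_right, ?_⟩
  rintro Q ((hQ | hQ) | hQ) hne
  · exact hr₁ Q hQ
  · exact absurd hQ hne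
  · exact hr₂ Q hQ

end Construction

/-! ### Isolated paws and value-stable pairs -/

section Main

variable {n k : ℕ} {d : Fin n → ℝ × ℝ}

open ElnitskyPolygon

/-- An empty paw has no edges and so determines no path; this case is settled apart with `w' = w`
and `v = 1`. -/
theorem valueStable_of_size_zero (p : Equiv.Perm (Fin 0)) (w : Equiv.Perm (Fin n)) :
    ValueStable p w := by
  refine ⟨w, 1, by simp, ?_, (Fin.castLEOrderEmb (Nat.zero_le n)), fun i => i.elim0,
    ⟨0, fun i => i.elim0⟩, (Fin.castLEOrderEmb (Nat.zero_le n)), fun i => i.elim0, rfl⟩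
  rw [permLength_eq_invCount 1, invCount_eq_zero_of_pairwise_lt pairwise_lt_ofFn_one, add_zero]

theorem pair_sublist_ofFn {w : Equiv.Perm (Fin n)} {x y : Fin n} :
    [x, y].Sublist (List.ofFn w) ↔ w⁻¹ x < w⁻¹ y := by
  have hnd : (List.ofFn w).Nodup := List.nodup_ofFn.2 w.injective
  have key : ∀ x y : Fin n, [x, y].Sublist (List.ofFn w) → w⁻¹ x < w⁻¹ y := by
    intro x y
    have : (List.ofFn w).Pairwise fun x y => w⁻¹ x < w⁻¹ y := by
      rw [List.pairwise_ofFn]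
      intro i j h
      simpa using h
    exact fun h => List.pairwise_iff_forall_sublist.1 this h
  refine ⟨key x y, fun h => ?_⟩
  have hmem : ∀ z, z ∈ List.ofFn w := fun z => (List.mem_ofFn' _ _).2 ⟨w⁻¹ z, by simp⟩
  rcases pair_sublist_total (fun e => h.ne (by rw [e])) (hmem x) (hmem y) with h' | h'
  · exact h'
  · exact absurd (key y x h') (lt_asymm h)

/-- In a path below `w` along an isolated paw, no ascent of the right half of the paw is an inversion
of `w`. -/
theorem IsIsolatedPaw.not_inversion (hd : IsEdgeSystem d) {w : Equiv.Perm (Fin n)}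
    {P : ElnitskyPolygon n} (hP : IsIsolatedPaw d w P) {A B : List (Fin n)}
    (hA : labelSum d A = P.top) (hle : WeakLE (A ++ P.rightList ++ B) (List.ofFn w))
    {R₁ R₂ : List (Fin n)} {a b : Fin n} (hR : P.rightList = R₁ ++ a :: b :: R₂) (hab : a < b) :
    ¬ [b, a].Sublist (List.ofFn w) := by
  intro hba
  have hnd : (List.ofFn w).Nodup := List.nodup_ofFn.2 w.injective
  have e1 : A ++ P.rightList ++ B = (A ++ R₁) ++ a :: b :: (R₂ ++ B) := by simp [hR]
  have hstep : SwapStep (A ++ P.rightList ++ B) ((A ++ R₁) ++ b :: a :: (R₂ ++ B)) :=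
    ⟨_, _, a, b, hab, e1, rfl⟩
  have hle' : WeakLE ((A ++ R₁) ++ b :: a :: (R₂ ++ B)) (List.ofFn w) := by
    -- The exchange adds one inversion, that of `a` and `b`, which is assumed to be one of `w`.
    refine weakLE_of_inversions hnd (hstep.perm.symm.trans (WeakLE.perm hle)) ?_
    intro x y hxy hs
    by_cases e : x = a ∧ y = b
    · obtain ⟨rfl, rfl⟩ := e
      exact hba
    · refine WeakLE.inversion hle hxy ?_
      rw [e1]
      rw [pair_sublist_append, pair_sublist_cons, pair_sublist_cons] at hs ⊢
      simp only [List.mem_cons] at hs ⊢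
      grind
  obtain ⟨T₃, hT₃, hr₃⟩ := WeakLE.exists_rhombus_tiling hd hle'
  have hrh := IsTilingBetween.rhombus hd (A ++ R₁) (R₂ ++ B) hab
  rw [← e1] at hrh
  obtain ⟨T, hT, hPT, hsub, hr⟩ := exists_pawTiling_of_path hd hA (hrh.trans hT₃) (by
    rintro Q (rfl | hQ)
    · exact rhombus_isRhombus _ _
    · exact hr₃ Q hQ)
  -- If `P` were this rhombus, its right half `b a` would have to be the ascent `a b`.
  have hQP : rhombus (labelSum d (A ++ R₁)) hab ≠ P := by
    intro e
    have h1 := rhombus_rightList (labelSum d (A ++ R₁)) hab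
    rw [e, hR] at h1
    have hl := congrArg List.length h1
    simp only [List.length_append, List.length_cons, List.length_nil] at hl
    obtain rfl : R₁ = [] := List.length_eq_zero_iff.1 (by omega)
    simp only [List.nil_append, List.cons.injEq] at h1
    exact hab.ne h1.1
  refine hP T hT hPT hr _ (hsub (Or.inl rfl)) hQP ⟨(labelSum d (A ++ R₁), a),
    (labelSum d (A ++ R₁) + d a, b), ?_, Or.inl ?_, Or.inl ?_, ?_, ?_⟩
  · intro e
    exact hab.ne (congrArg Prod.snd e)
  · rw [leftEdges_eq, rhombus_leftList]
    exact ⟨[], [b], rfl, by simp [rhombus]⟩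
  · rw [leftEdges_eq, rhombus_leftList]
    exact ⟨[a], [], rfl, by simp [rhombus]⟩
  · rw [rightEdges_eq, hR]
    exact ⟨R₁, b :: R₂, rfl, by simp [hA]⟩
  · rw [rightEdges_eq, hR]
    exact ⟨R₁ ++ [a], R₂, by simp, by simp [hA, add_assoc]⟩

/-- The path `A R B` through the right half of the paw is the word of `w'`, in which `R` fills
consecutive positions. It remains to see that `R` keeps its order in `w`, which need only be checked
for neighbours. -/
theorem valueStable_of_isolated (hd : IsEdgeSystem d) {w : Equiv.Perm (Fin n)}
    {p : Equiv.Perm (Fin k)} {T : Set (ElnitskyPolygon n)} (hT : IsPawTiling d w T)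
    {P : ElnitskyPolygon n} (hPT : P ∈ T) (hPp : P.IsPaw p) (hP : IsIsolatedPaw d w P) :
    ValueStable p w := by
  obtain ⟨t, l, rfl⟩ := hPp
  rcases k with _ | k
  · exact valueStable_of_size_zero p w
  set P : ElnitskyPolygon n := ⟨k + 1, t, l, p⟩ with hPdef
  have hRl : P.rightList = List.ofFn fun i => l (p i) := rfl
  have hlen : P.rightList.length = k + 1 := by rw [hRl, List.length_ofFn]
  obtain ⟨A, B, hA, hle⟩ := hT.exists_weakLE hd hPT (by
    intro h; rw [h] at hlen; simp at hlen)
  obtain ⟨u, hu⟩ := exists_perm_ofFn_eq (WeakLE.perm hle).symm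
  have hAn : A.length + (k + 1) ≤ n := by
    have := congrArg List.length hu
    simp only [List.length_ofFn, List.length_append, hlen] at this
    omega
  have huv : ∀ i : Fin (k + 1), u ⟨A.length + i, by omega⟩ = l (p i) := by
    intro i
    have h1 : (List.ofFn u)[A.length + i]'(by simp; omega) = u ⟨A.length + i, by omega⟩ := by
      simp
    rw [← h1]
    simp only [hu, List.append_assoc]
    rw [List.getElem_append_right (by omega), List.getElem_append_left (by omega)]
    rw [List.getElem_of_eq hRl]
    simp only [List.getElem_ofFn, Nat.add_sub_cancel_left, Fin.eta]
  let f' : Fin (k + 1) ↪o Fin n :=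
    OrderEmbedding.ofStrictMono (fun i => ⟨A.length + i, by omega⟩) (by
      intro i j h
      simpa using h)
  have hf' : ∀ i, u (f' i) = l (p i) := huv
  let g : Fin (k + 1) → Fin n := fun i => w⁻¹ (l (p i))
  have hg : StrictMono g := by
    rw [Fin.strictMono_iff_lt_succ]
    intro i
    have hR := ofFn_eq_take_append_cons_cons_drop (fun i => l (p i))
      (i := i.castSucc) (j := i.succ) (by simp)
    rw [← hRl] at hR
    have hne : l (p i.castSucc) ≠ l (p i.succ) := fun e =>
      absurd (p.injective (l.injective e)) (Fin.castSucc_lt_succ).ne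
    simp only [g]
    -- An ascent keeps its order because the paw is isolated, a descent because inversions persist
    -- upwards in the weak order.
    rcases lt_or_gt_of_ne hne with h | h
    · have h' := hP.not_inversion hd hA hle hR h
      rw [pair_sublist_ofFn, not_lt] at h'
      exact lt_of_le_of_ne h' fun e => hne (w⁻¹.injective e)
    · rw [← pair_sublist_ofFn]
      refine WeakLE.inversion hle h ?_
      rw [hR]
      simp
  have hwg : ∀ i, w (OrderEmbedding.ofStrictMono g hg i) = l (p i) := fun i => by
    simp [g]
  refine ⟨u, u⁻¹ * w, by simp, permLength_add_of_weakLE (hu ▸ hle), f', ?_,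
    ⟨A.length, fun i => rfl⟩, OrderEmbedding.ofStrictMono g hg, ?_, ?_⟩
  · intro i j
    rw [hf', hf', l.lt_iff_lt]
  · intro i j
    rw [hwg, hwg, l.lt_iff_lt]
  · simp only [hwg, hf']

/-- The two edges that a rhombus shares with the right half of another tile are its left half. -/
theorem SharesTwoRightEdges.exists_ascent (hd : IsEdgeSystem d) {w : Equiv.Perm (Fin n)}
    {T : Set (ElnitskyPolygon n)} (hT : IsPawTiling d w T) {P Q : ElnitskyPolygon n} (hP : P ∈ T)
    (hQ : Q ∈ T) (hne : Q ≠ P) {a b : Fin n} (hab : a < b) (hQl : Q.leftList = [a, b])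
    (hQr : Q.rightList = [b, a]) (h : SharesTwoRightEdges d Q P) :
    [a, b].Sublist P.rightList := by
  have hRn : P.rightList.Nodup :=
    P.leftList_perm.nodup_iff.1 (P.leftList_sorted.imp ne_of_lt)
  have inj : ∀ {A B A' B' : List (Fin n)}, P.rightList = A ++ B → P.rightList = A' ++ B' →
      P.top + labelSum d A = P.top + labelSum d A' → A = A' ∧ B = B' := fun h1 h2 h3 =>
    append_inj_of_labelSum hd.down (h1.symm.trans h2) (add_left_cancel h3)
  -- two edges of `P` with the same upper vertex are equal
  have same_top : ∀ v x y, (v, x) ∈ listEdges d P.top P.rightList →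
      (v, y) ∈ listEdges d P.top P.rightList → x = y := by
    rintro v x y ⟨A, B, h1, h2⟩ ⟨A', B', h3, h4⟩
    have := (inj h1 h3 (h2.symm.trans h4)).2
    simp only [List.cons.injEq] at this
    exact this.1
  -- two edges of `P` with the same label are equal
  have same_label : ∀ v v' x, (v, x) ∈ listEdges d P.top P.rightList →
      (v', x) ∈ listEdges d P.top P.rightList → v = v' := by
    rintro v v' x ⟨A, B, h1, h2⟩ ⟨A', B', h3, h4⟩
    simp only at h1 h2 h3 h4
    have hA : A = A' := by
      rw [h1] at hRn h3
      rcases List.append_eq_append_iff.1 h3 with ⟨C, rfl, h⟩ | ⟨C, rfl, h⟩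
      · rcases C with _ | ⟨c, C⟩
        · simp
        · simp only [List.cons_append, List.cons.injEq] at h
          obtain ⟨rfl, rfl⟩ := h
          exact absurd hRn (by simp [List.nodup_append])
      · rcases C with _ | ⟨c, C⟩
        · simp
        · simp only [List.cons_append, List.cons.injEq] at h
          obtain ⟨rfl, rfl⟩ := h
          exact absurd hRn (by simp [List.nodup_append])
    rw [h2, h4, hA]
  have dne : ∀ x, d x ≠ 0 := fun x h => by
    have := hd.down x
    rw [h] at this
    simp at this
  have left_left : (Q.top, a) ∈ listEdges d P.top P.rightList →
      (Q.top + d a, b) ∈ listEdges d P.top P.rightList → [a, b].Sublist P.rightList := by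
    rintro ⟨A, B, h1, h2⟩ ⟨A', B', h3, h4⟩
    simp only at h1 h2 h3 h4
    have h5 : P.rightList = (A ++ [a]) ++ B := by simp [h1]
    have := (inj h5 h3 (by rw [← h4, h2]; simp [add_assoc])).2
    rw [h1, this]
    simp
  -- Both tiles would have interior points just to the left of the same vertex, hence overlap.
  have right_right : (Q.top, b) ∈ listEdges d P.top P.rightList →
      (Q.top + d b, a) ∈ listEdges d P.top P.rightList → False := by
    rintro ⟨A, B, h1, h2⟩ ⟨A', B', h3, h4⟩
    simp only at h1 h2 h3 h4
    have h5 : P.rightList = (A ++ [b]) ++ B := by simp [h1]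
    have hv : P.top + labelSum d (A ++ [b]) = Q.top + d b := by rw [h2]; simp [add_assoc]
    have hB := (inj h5 h3 (by rw [hv, h4])).2
    obtain ⟨ε, hε, hint⟩ := P.exists_mem_interior_left_of_right hd (x := b) (y := a) h5 (by simp)
      (by simp [hB]) hab
    obtain ⟨ε', hε', hint'⟩ := Q.exists_mem_interior_left_of_right hd (A := [b]) (B := [a])
      (x := b) (y := a) hQr (by simp) (by simp) hab
    obtain ⟨δ, hδ0, hδ⟩ := exists_between (lt_min hε hε')
    have m1 := hint δ hδ0 (hδ.trans_le (min_le_left _ _))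
    have m2 := hint' δ hδ0 (hδ.trans_le (min_le_right _ _))
    rw [hv] at m1
    simp only [labelSum_cons, labelSum_nil, add_zero] at m2
    exact Set.disjoint_left.1 (hT.no_overlap P hP Q hQ hne.symm) m1 (interior_subset m2)
  -- The two lower edges of `Q` end at one vertex, while a strictly descending path enters each
  -- vertex by a single edge.
  have bottoms : (Q.top + d a, b) ∈ listEdges d P.top P.rightList →
      (Q.top + d b, a) ∈ listEdges d P.top P.rightList → False := by
    rintro ⟨A, B, h1, h2⟩ ⟨A', B', h3, h4⟩
    simp only at h1 h2 h3 h4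
    rw [h1] at h3
    have e : P.top + labelSum d A + d b = P.top + labelSum d A' + d a := by
      rw [← h2, ← h4]; abel
    rcases List.append_eq_append_iff.1 h3 with ⟨C, rfl, h⟩ | ⟨C, rfl, h⟩
    · rcases C with _ | ⟨c, C⟩
      · simp only [List.nil_append, List.cons.injEq] at h
        exact hab.ne h.1.symm
      · simp only [List.cons_append, List.cons.injEq] at h
        obtain ⟨rfl, -⟩ := h
        have e2 := congrArg Prod.snd e
        simp only [labelSum_append, labelSum_cons, Prod.snd_add] at e2
        linarith [hd.down a, labelSum_snd_nonpos hd.down C]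
    · rcases C with _ | ⟨c, C⟩
      · simp only [List.nil_append, List.cons.injEq] at h
        exact hab.ne h.1
      · simp only [List.cons_append, List.cons.injEq] at h
        obtain ⟨rfl, -⟩ := h
        have e2 := congrArg Prod.snd e
        simp only [labelSum_append, labelSum_cons, Prod.snd_add] at e2
        linarith [hd.down b, labelSum_snd_nonpos hd.down C]
  obtain ⟨e₁, e₂, hne₁₂, h1, h2, h3, h4⟩ := h
  rw [rightEdges_eq] at h3 h4
  have hcases : ∀ e, e ∈ Q.leftEdges d ∪ Q.rightEdges d →
      e = (Q.top, a) ∨ e = (Q.top + d a, b) ∨ e = (Q.top, b) ∨ e = (Q.top + d b, a) := by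
    intro e he
    rw [leftEdges_eq, rightEdges_eq, hQl, hQr] at he
    simp only [listEdges_cons, listEdges_nil, Set.mem_union, Set.mem_singleton_iff,
      Set.mem_empty_iff_false, or_false] at he
    tauto
  rcases hcases e₁ h1 with rfl | rfl | rfl | rfl <;> rcases hcases e₂ h2 with rfl | rfl | rfl | rfl
  · exact absurd rfl hne₁₂
  · exact left_left h3 h4
  · exact absurd (same_top _ _ _ h3 h4) hab.ne
  · exact absurd (same_label _ _ _ h3 h4) (by simpa using dne b)
  · exact left_left h4 h3
  · exact absurd rfl hne₁₂
  · exact absurd (same_label _ _ _ h4 h3) (by simpa using dne a)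
  · exact (bottoms h3 h4).elim
  · exact absurd (same_top _ _ _ h4 h3) hab.ne
  · exact absurd (same_label _ _ _ h3 h4) (by simpa using dne a)
  · exact absurd rfl hne₁₂
  · exact (right_right h3 h4).elim
  · exact absurd (same_label _ _ _ h4 h3) (by simpa using dne b)
  · exact (bottoms h4 h3).elim
  · exact (right_right h4 h3).elim
  · exact absurd rfl hne₁₂

/-- A paw whose right-hand labels occur in `w` in the same order is isolated. -/
theorem isIsolatedPaw_of_sublist (hd : IsEdgeSystem d) {w : Equiv.Perm (Fin n)}
    {P : ElnitskyPolygon n} (h : P.rightList.Sublist (List.ofFn w)) : IsIsolatedPaw d w P := by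
  intro T hT hP hr Q hQ hne hshare
  obtain ⟨t, l, hQe⟩ := hr Q hQ hne
  have hab : l 0 < l 1 := l.strictMono (by decide)
  have hQl : Q.leftList = [l 0, l 1] := by
    rw [hQe, leftList_of_size_two]
  have hQr : Q.rightList = [l 1, l 0] := by
    rw [hQe, rightList_of_swap]
  have hs := hshare.exists_ascent hd hT hP hQ hne hab hQl hQr
  -- The right half `b a` of the rhombus itself extends to a path below `w`, so `w` inverts this
  -- pair.
  obtain ⟨A, B, -, hle⟩ := hT.exists_weakLE hd hQ (by simp [hQr])
  have hinv := WeakLE.inversion hle hab (by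
    rw [hQr]
    simp)
  exact not_pair_sublist_swap (List.nodup_ofFn.2 w.injective) (hs.trans h) hinv

/-- The consecutive pattern of `w'` is the right half of a paw along the path `w'`, and the rest is
filled with rhombi. Since the same values occur in `w` in the same order, the paw is isolated. -/
theorem exists_isolated_of_valueStable (hd : IsEdgeSystem d) {w : Equiv.Perm (Fin n)}
    {p : Equiv.Perm (Fin k)} (h : ValueStable p w) :
    ∃ T : Set (ElnitskyPolygon n), IsPawTiling d w T ∧
      ∃ P ∈ T, P.IsPaw p ∧ IsIsolatedPaw d w P := by
  obtain ⟨u, v, rfl, hlen, f', hf', ⟨x, hx⟩, f, hf, hrange⟩ := h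
  have hle := weakLE_of_permLength_add hlen
  have mono : ∀ {u : Equiv.Perm (Fin n)} {f : Fin k ↪o Fin n}, IsPatternAt p u f →
      StrictMono fun j => u (f (p⁻¹ j)) := by
    intro u f hf i j hij
    exact (hf _ _).1 (by simpa using hij)
  let l : Fin k ↪o Fin n := OrderEmbedding.ofStrictMono _ (mono hf')
  have hl : ∀ i, l (p i) = u (f' i) := fun i => by simp [l]
  -- Read through `p⁻¹`, both occurrences list their values increasingly; having the same range,
  -- they agree entry by entry.
  have hw : ∀ i, (u * v) (f i) = u (f' i) := by
    have e : (fun j => (u * v) (f (p⁻¹ j))) = fun j => u (f' (p⁻¹ j)) := by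
      refine (StrictMono.range_inj (mono hf) (mono hf')).1 ?_
      have c : ∀ g : Fin k → Fin n, Set.range (fun j => g (p⁻¹ j)) = Set.range g := fun g =>
        (p⁻¹).surjective.range_comp g
      rw [c fun i => (u * v) (f i), c fun i => u (f' i)]
      exact hrange
    intro i
    have := congrFun e (p i)
    simpa using this
  let A := (List.ofFn u).take x
  let P : ElnitskyPolygon n := ⟨k, labelSum d A, l, p⟩
  have hPr : P.rightList = List.ofFn fun i => u (f' i) := by
    simp only [rightList, P, hl]
  have hsplit : List.ofFn u = A ++ P.rightList ++ (List.ofFn u).drop (x + k) := by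
    have e1 : P.rightList = ((List.ofFn u).drop x).take k := by
      rw [hPr]
      -- For `k = 0` the starting position `x` is unconstrained and may exceed `n`.
      have hxk : k = 0 ∨ x + k ≤ n := by
        rcases k with _ | k
        · exact Or.inl rfl
        · have := hx (Fin.last k)
          have := (f' (Fin.last k)).isLt
          simp at *
          omega
      apply List.ext_getElem
      · simp
        omega
      · intro i h1 h2
        simp only [List.getElem_ofFn, List.getElem_take, List.getElem_drop]
        congr 1
        ext
        simp [hx]
    rw [e1, List.append_assoc, ← List.drop_drop, List.take_append_drop, List.take_append_drop]
  rw [hsplit] at hle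
  obtain ⟨T₂, hT₂, hr₂⟩ := WeakLE.exists_rhombus_tiling hd hle
  obtain ⟨T, hT, hPT, -, -⟩ := exists_pawTiling_of_path hd (P := P) rfl hT₂ hr₂
  refine ⟨T, hT, P, hPT, ⟨_, l, rfl⟩, isIsolatedPaw_of_sublist hd ?_⟩
  rw [hPr]
  have e : (List.ofFn fun i => u (f' i)) = (List.ofFn f).map (u * v) := by
    rw [List.map_ofFn]
    congr 1
    funext i
    exact (hw i).symm
  have e' : List.ofFn (u * v) = (List.finRange n).map (u * v) := List.ofFn_eq_map
  rw [e, e']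
  refine List.Sublist.map _ ?_
  have hs1 : (List.ofFn f).Pairwise (· < ·) := by
    rw [List.pairwise_ofFn]
    exact fun i j h => f.strictMono h
  have hs2 : (List.finRange n).Pairwise (· < ·) := List.pairwise_lt_finRange n
  exact List.sublist_of_subperm_of_pairwise
    (List.subperm_of_subset (hs1.imp ne_of_lt) fun y _ => List.mem_finRange y) hs1 hs2

end Main

theorem corollary4p11 {n k : ℕ} (d : Fin n → ℝ × ℝ) (hd : IsEdgeSystem d)
    (w : Equiv.Perm (Fin n)) (p : Equiv.Perm (Fin k)) :
    (∃ T : Set (ElnitskyPolygon n), IsPawTiling d w T ∧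
      ∃ P ∈ T, P.IsPaw p ∧ IsIsolatedPaw d w P) ↔
    ValueStable p w := by
  constructor
  · rintro ⟨T, hT, P, hPT, hPp, hP⟩
    exact valueStable_of_isolated hd hT hPT hPp hP
  · exact exists_isolated_of_valueStable hd
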